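/- **Theorem (the triple dimension sweep computes the Hessian of the 3-D hypervolume indicator).** *Setting.* For $y,z\in\mathbb{R}^3$ write $y\prec z$ if $y_k\le z_k$ for all $k$ and $y_k<z_k$ for some $k$. For a reference point $r\in\mathbb{R}^3$ and $\mathbf{Y}=(y^{(1)},\dots,y^{(n)})\in(\mathbb{R}^3)^n\cong\mathbb{R}^{3n}$ let $$\mathcal{H}(\mathbf{Y})=\lambda_3\big(\{p\in\mathbb{R}^3:\ y^{(i)}\prec p\prec r\ \text{for some } i\}\big),$$ a function of the $3n$ concatenated coordinates $y^{(i)}_k$. *Algorithm (three sweeps).* For each $(l,w,h)\in\{(1,2,3),(1,3,2),(3,2,1)\}$ do the following. Introduce sentinels $y^{(0)}$ with $y^{(0)}_l=-\infty$, $y^{(0)}_w=r_w$, $y^{(0)}_h=r_h$ and $y^{(n+1)}$ with $y^{(n+1)}_l=r_l$, $y^{(n+1)}_w=-\infty$, $y^{(n+1)}_h=r_h$. Start with the list $T=(y^{(0)},y^{(n+1)})$, which is kept sorted ascendingly in the $l$-coordinate. Process the points of $\mathbf{Y}$ in ascending order of their $h$-coordinate. To process a point $a$: 1. Let $d_0$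 be the element of $T$ with the highest $l$-coordinate not exceeding $a_l$, let $d_{N+1}$ be the first element of $T$ after $d_0$ whose $w$-coordinate does not exceed $a_w$, and let $d_1,\dots,d_N$ ($N\ge 0$) be the elements of $T$ between them. Write $x_j=(d_j)_l$ and $z_j=(d_j)_w$. 2. Record the values $$\frac{\partial^2\mathcal{H}}{\partial a_h\,\partial a_l}=z_0-a_w,\quad \frac{\partial^2\mathcal{H}}{\partial a_h\,\partial a_w}=x_{N+1}-a_l,\quad \frac{\partial^2\mathcal{H}}{\partial a_h\,\partial (d_0)_w}=-(x_1-a_l),\quad \frac{\partial^2\mathcal{H}}{\partial a_h\,\partial (d_{N+1})_l}=-(z_N-a_w),$$ $$\frac{\partial^2\mathcal{H}}{\partial a_h\,\partial (d_j)_l}=-(z_{j-1}-z_j),\qquad \frac{\partial^2\mathcal{H}}{\partial a_h\,\partial (d_j)_w}=-(x_{j+1}-x_j)\qquad(1\le j\le N),$$ omitting every value for which $d_0$ or $d_{N+1}$, occurring as the variable of differentiation, is a sentinel. 3. Remove $d_1,\dots,d_N$ from $T$ and insert $a$. The *polygon swept* in this iteration is the ortho-convex polygon $P=\bigcup_{j=0}^{N}[a_l,x_{j+1}]\times[a_w,z_j]$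 in the $lw$-plane. The output of the algorithm is the list of all recorded values, with their row and column indices, over the three sweeps. *Claim.* Let $n$ points $y^{(1)},\dots,y^{(n)}\in\mathbb{R}^3$ be mutually non-dominated and in general position ($y^{(i)}_k\ne y^{(j)}_k$ for all $i\ne j$ and all $k$), and suppose that they dominate the reference point strictly in every coordinate ($y^{(i)}_k<r_k$ for all $i,k$). Then: 1. $\mathcal{H}$ is twice continuously differentiable at $\mathbf{Y}$, so that its Hessian matrix with respect to the concatenated coordinates exists there. 2. The algorithm computes all non-zero entries of this Hessian matrix, correctly, and nothing else: the row/column pairs $((i,k),(j,c))$ for which it records a value are exactly those with $\partial^2\mathcal{H}/\partial y^{(i)}_k\partial y^{(j)}_c\neq0$, and the recorded value is this derivative. 3. These entries are, up to sign, edge lengths of the polygons swept in the iterations: a value recorded in the iteration that processes $a$, with polygon $P$, for the column $y^{(j)}_c$ ($c\in\{l,w\}$) equals $\varepsilon$ times the length of the edge of $P$ on the line of the $lw$-plane on which the $c$-coordinate is $y^{(j)}_c$, where $\varepsilon=+1$ if $y^{(j)}=a$ and $\varepsilon=-1$ otherwise. -/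

import Mathlib

open MeasureTheory

namespace TriSweep

noncomputable section

/-! ### Pareto dominance and the hypervolume indicator (minimization) -/

/-- Pareto dominance `y ≺ z` for minimization. -/
def Dominates {κ : Type*} (y z : κ → ℝ) : Prop :=
  (∀ k, y k ≤ z k) ∧ ∃ k, y k < z k

/-- The hypervolume indicator of a set `S`, cut from above by the reference point `r`. -/
def HV {κ : Type*} [Fintype κ] (r : κ → ℝ) (S : Set (κ → ℝ)) : ℝ :=
  (volume {p : κ → ℝ | ∃ y ∈ S, Dominates y p ∧ Dominates p r}).toReal

/-- Concatenation of `n` points into one vector; the coordinate `y^{(i)}_k` has index `(i, k)`. -/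
def concat {n : ℕ} {κ : Type*} (Y : Fin n → κ → ℝ) : Fin n × κ → ℝ :=
  fun p => Y p.1 p.2

/-- The hypervolume indicator as a function of the concatenated coordinates. -/
def hypervolume {n : ℕ} {κ : Type*} [Fintype κ] (r : κ → ℝ) (V : Fin n × κ → ℝ) : ℝ :=
  HV r (Set.range fun (i : Fin n) (k : κ) => V (i, k))

/-- The Hessian matrix of `f` at `x`: the entry `(p, q)` is `∂/∂x_q (∂f/∂x_p)`. -/
def hessian {ι : Type*} [Fintype ι] [DecidableEq ι] (f : (ι → ℝ) → ℝ) (x : ι → ℝ) :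
    Matrix ι ι ℝ :=
  fun p q => fderiv ℝ (fun z => fderiv ℝ f z (Pi.single p 1)) x (Pi.single q 1)

/-! ### The triple dimension sweep -/

/-- What the search tree stores: the sentinel `y^{(0)}`, the points, the sentinel `y^{(n+1)}`. -/
inductive Node (n : ℕ) where
  | first : Node n
  | point (i : Fin n) : Node n
  | last : Node n

/-- Coordinates of a node in the sweep with in-plane axes `l`, `w`: the sentinel `y^{(0)}` has
`l`-coordinate `-∞`, the sentinel `y^{(n+1)}` has `w`-coordinate `-∞`, and their other coordinates
are those of the reference point. -/
def Node.coord {n : ℕ} (r : Fin 3 → ℝ) (Y : Fin n → Fin 3 → ℝ) (l w : Fin 3) :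
    Node n → Fin 3 → EReal
  | .first, c => if c = l then ⊥ else ((r c : ℝ) : EReal)
  | .point i, c => ((Y i c : ℝ) : EReal)
  | .last, c => if c = w then ⊥ else ((r c : ℝ) : EReal)

/-- A computed entry of the Hessian matrix: its row, its column and its value. -/
structure Entry (n : ℕ) where
  row : Fin n × Fin 3
  col : Fin n × Fin 3
  val : ℝ

/-- One iteration: the sweep axes, the processed point `a`, and the nodes
`d_0`, `[d_1, …, d_N]`, `d_{N+1}`. -/
structure Step (n : ℕ) where
  l : Fin 3
  w : Fin 3
  h : Fin 3
  a : Fin n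
  left : Node n
  inner : List (Node n)
  right : Node n

variable {n : ℕ} (r : Fin 3 → ℝ) (Y : Fin n → Fin 3 → ℝ)

/-- The nodes `d_0, …, d_{N+1}` of an iteration. -/
def Step.d (s : Step n) (j : ℕ) : Node n :=
  (s.left :: (s.inner ++ [s.right])).getD j s.right

/-- The number `N` of tree points that `a` dominates in the `lw`-plane. -/
def Step.N (s : Step n) : ℕ := s.inner.length

/-- The `l`-coordinate of `d_j` as a real number (used for `1 ≤ j ≤ N + 1`). -/
def Step.dl (s : Step n) (j : ℕ) : ℝ := ((s.d j).coord r Y s.l s.w s.l).toReal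

/-- The `w`-coordinate of `d_j` as a real number (used for `0 ≤ j ≤ N`). -/
def Step.dw (s : Step n) (j : ℕ) : ℝ := ((s.d j).coord r Y s.l s.w s.w).toReal

/-- Record the value `x` for `∂²H / ∂y^{(a)}_h ∂v_c`; there is nothing to record for a sentinel,
whose coordinates are not variables of `H`. -/
def record (a : Fin n) (h : Fin 3) (v : Node n) (c : Fin 3) (x : ℝ) : List (Entry n) :=
  match v with
  | .point j => [⟨(a, h), (j, c), x⟩]
  | _ => []

/-- The entries computed in one iteration. -/
def Step.entries (s : Step n) : List (Entry n) :=
  record s.a s.h (.point s.a) s.l (s.dw r Y 0 - Y s.a s.w) ++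
  record s.a s.h (.point s.a) s.w (s.dl r Y (s.N + 1) - Y s.a s.l) ++
  record s.a s.h (s.d 0) s.w (-(s.dl r Y 1 - Y s.a s.l)) ++
  record s.a s.h (s.d (s.N + 1)) s.l (-(s.dw r Y s.N - Y s.a s.w)) ++
  (List.range s.N).flatMap fun i =>
    record s.a s.h (s.d (i + 1)) s.l (-(s.dw r Y i - s.dw r Y (i + 1))) ++
    record s.a s.h (s.d (i + 1)) s.w (-(s.dl r Y (i + 2) - s.dl r Y (i + 1)))

/-- The ortho-convex polygon swept in one iteration, in the coordinates `(l, w)`. Its corners,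
starting at the processed point `a` and writing `d_j = (x_j, z_j)`, are `a`, `(x_{N+1}, a_w)`,
`(x_{N+1}, z_N)`, `(x_N, z_N)`, `(x_N, z_{N-1})`, …, `(x_1, z_0)`, `(a_l, z_0)`. -/
def Step.polygon (s : Step n) : Set (ℝ × ℝ) :=
  ⋃ j ∈ Finset.range (s.N + 1),
    Set.Icc (Y s.a s.l) (s.dl r Y (j + 1)) ×ˢ Set.Icc (Y s.a s.w) (s.dw r Y j)

/-- The iteration that processes `a`, for the list `T` of tree nodes (ascending in `l`).
`d_0` is the node of `T` with the highest `l`-coordinate not exceeding that of `a`, `d_{N+1}` the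
next node whose `w`-coordinate does not exceed that of `a`. Returned with it is the updated list:
`d_1, …, d_N` are discarded and `a` is inserted. -/
def step (l w h : Fin 3) (T : List (Node n)) (a : Fin n) : Step n × List (Node n) :=
  let lower := T.takeWhile fun v => decide (v.coord r Y l w l ≤ ((Y a l : ℝ) : EReal))
  let rest := T.dropWhile fun v => decide (v.coord r Y l w l ≤ ((Y a l : ℝ) : EReal))
  let inner := rest.takeWhile fun v => decide (((Y a w : ℝ) : EReal) < v.coord r Y l w w)
  let upper := rest.dropWhile fun v => decide (((Y a w : ℝ) : EReal) < v.coord r Y l w w)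
  (⟨l, w, h, a, lower.getLastD .first, inner, upper.headD .last⟩, lower ++ .point a :: upper)

/-- The iterations that process the listed points in order, starting from the tree list `T`. -/
def sweepFrom (l w h : Fin 3) : List (Node n) → List (Fin n) → List (Step n)
  | _, [] => []
  | T, a :: as => (step r Y l w h T a).1 :: sweepFrom l w h (step r Y l w h T a).2 as

/-- One sweep: the points are processed from best to worst `h`-coordinate (ascending, as the
coordinates are minimized), and the tree initially holds the two sentinels. -/
def sweep (l w h : Fin 3) : List (Step n) :=
  sweepFrom r Y l w h [.first, .last]
    ((List.finRange n).mergeSort fun i j => decide (Y i h ≤ Y j h))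

/-- All iterations of the three sweeps, `(l, w, h) = (1,2,3), (1,3,2), (3,2,1)` (with the
coordinates numbered from `0` here). -/
def steps : List (Step n) :=
  sweep r Y 0 1 2 ++ sweep r Y 0 2 1 ++ sweep r Y 2 1 0

/-- The output of the triple dimension sweep. -/
def triSweep : List (Entry n) :=
  (steps r Y).flatMap fun s => s.entries r Y

/-! ### Edges of a rectilinear polygon -/

/-- The total length of the edges of `P` on the line where the first coordinate is `x`. -/
def edgeLengthFst (P : Set (ℝ × ℝ)) (x : ℝ) : ℝ :=
  (volume {z : ℝ | (x, z) ∈ frontier P}).toReal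

/-- The total length of the edges of `P` on the line where the second coordinate is `z`. -/
def edgeLengthSnd (P : Set (ℝ × ℝ)) (z : ℝ) : ℝ :=
  (volume {x : ℝ | (x, z) ∈ frontier P}).toReal

end

end TriSweep

namespace TriSweep

noncomputable section

variable {n : ℕ} {r : Fin 3 → ℝ} {Y : Fin n → Fin 3 → ℝ} {l w h : Fin 3}

/-! ### Points in general position -/

/-- The points are mutually non-dominated, in general position, and strictly below `r`. -/
structure Generic {n : ℕ} (r : Fin 3 → ℝ) (Y : Fin n → Fin 3 → ℝ) : Prop where
  not_dominates : ∀ i j, ¬ Dominates (Y i) (Y j)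
  ne : ∀ i j, i ≠ j → ∀ k, Y i k ≠ Y j k
  lt_ref : ∀ i k, Y i k < r k

/-- `l`, `w`, `h` are the three axes. -/
structure Axes (l w h : Fin 3) : Prop where
  lw : l ≠ w
  lh : l ≠ h
  wh : w ≠ h

theorem Axes.exhaust {l w h : Fin 3} (hx : Axes l w h) (k : Fin 3) : k = l ∨ k = w ∨ k = h := by
  have := hx.lw; have := hx.lh; have := hx.wh
  omega

@[simp] theorem Node.coord_point (i : Fin n) (c : Fin 3) :
    (Node.point i).coord r Y l w c = ((Y i c : ℝ) : EReal) := rfl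

theorem Node.coord_first_of_ne {c : Fin 3} (hc : c ≠ l) :
    (Node.first : Node n).coord r Y l w c = ((r c : ℝ) : EReal) := by
  simp [Node.coord, hc]

theorem Node.coord_last_of_ne {c : Fin 3} (hc : c ≠ w) :
    (Node.last : Node n).coord r Y l w c = ((r c : ℝ) : EReal) := by
  simp [Node.coord, hc]

theorem Node.coord_ne (hY : Generic r Y) {a : Fin n} {v : Node n} (hv : v ≠ .point a) (c : Fin 3) :
    v.coord r Y l w c ≠ ((Y a c : ℝ) : EReal) := by
  have := hY.lt_ref a c
  cases v with
  | first =>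
    by_cases hc : c = l
    · simp [Node.coord, hc]
    · simp [Node.coord, hc, this.ne']
  | last =>
    by_cases hc : c = w
    · simp [Node.coord, hc]
    · simp [Node.coord, hc, this.ne']
  | point i =>
    have hia : i ≠ a := fun e => hv (e ▸ rfl)
    simpa using hY.ne i a hia c

/-! ### The tree invariant -/

/-- `u` precedes `v` in a tree list: smaller in `l`, larger in `w`. -/
def Precedes (r : Fin 3 → ℝ) (Y : Fin n → Fin 3 → ℝ) (l w : Fin 3) (u v : Node n) : Prop :=
  u.coord r Y l w l < v.coord r Y l w l ∧ v.coord r Y l w w < u.coord r Y l w w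

/-- `T` represents the set `L` of processed points: a staircase of nodes between the sentinels,
below every point of `L`. -/
structure TreeInv (r : Fin 3 → ℝ) (Y : Fin n → Fin 3 → ℝ) (l w : Fin 3) (L : Set (Fin n))
    (T : List (Node n)) : Prop where
  pairwise : T.Pairwise (Precedes r Y l w)
  first_mem : Node.first ∈ T
  last_mem : Node.last ∈ T
  mem : ∀ i, Node.point i ∈ T → i ∈ L
  cover : ∀ i ∈ L, ∃ v ∈ T, v.coord r Y l w l ≤ ((Y i l : ℝ) : EReal) ∧
    v.coord r Y l w w ≤ ((Y i w : ℝ) : EReal)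

theorem not_of_mem_dropWhile {α : Type*} {p : α → Bool} {T : List α}
    (hT : T.Pairwise fun u v => p v → p u) : ∀ v ∈ T.dropWhile p, ¬ p v := by
  induction T with
  | nil => simp
  | cons b T ih =>
    rw [List.pairwise_cons] at hT
    rw [List.dropWhile_cons]
    split
    · exact ih hT.2
    · rename_i hb
      intro v hv
      rcases List.mem_cons.1 hv with rfl | hv
      · exact hb
      · exact fun hpv => hb (hT.1 v hv hpv)

/-- The position of the processed point `a` between the nodes `d0`, `inner`, `d1`. -/
structure Located (r : Fin 3 → ℝ) (Y : Fin n → Fin 3 → ℝ) (l w : Fin 3) (a : Fin n)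
    (d0 : Node n) (inner : List (Node n)) (d1 : Node n) : Prop where
  left_l : d0.coord r Y l w l < ((Y a l : ℝ) : EReal)
  left_w : ((Y a w : ℝ) : EReal) < d0.coord r Y l w w
  right_l : ((Y a l : ℝ) : EReal) < d1.coord r Y l w l
  right_w : d1.coord r Y l w w < ((Y a w : ℝ) : EReal)
  inner_l : ∀ v ∈ inner, ((Y a l : ℝ) : EReal) < v.coord r Y l w l
  inner_w : ∀ v ∈ inner, ((Y a w : ℝ) : EReal) < v.coord r Y l w w

theorem exists_step_eq (hY : Generic r Y) (hx : Axes l w h) {L : Set (Fin n)} {T : List (Node n)}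
    (hT : TreeInv r Y l w L T) {a : Fin n} (ha : ∀ j ∈ L, Y j h < Y a h) :
    ∃ lo d0 inner d1 up, T = lo ++ d0 :: (inner ++ d1 :: up) ∧
      step r Y l w h T a = (⟨l, w, h, a, d0, inner, d1⟩, lo ++ d0 :: .point a :: d1 :: up) ∧
      Located r Y l w a d0 inner d1 := by
  have hne : ∀ v ∈ T, ∀ c, v.coord r Y l w c ≠ ((Y a c : ℝ) : EReal) := fun v hv c =>
    Node.coord_ne hY (fun e => (ha a (hT.mem a (e ▸ hv))).false) c
  set p : Node n → Bool := fun v => decide (v.coord r Y l w l ≤ ((Y a l : ℝ) : EReal)) with hp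
  set q : Node n → Bool := fun v => decide (((Y a w : ℝ) : EReal) < v.coord r Y l w w) with hq
  have hpT : T.Pairwise fun u v => p v → p u := hT.pairwise.imp fun {u v} huv hv => by
    simp only [hp, decide_eq_true_eq] at hv ⊢
    exact huv.1.le.trans hv
  have hAB : T = T.takeWhile p ++ T.dropWhile p := List.takeWhile_append_dropWhile.symm
  have hBq : (T.dropWhile p).Pairwise fun u v => q v → q u :=
    (hT.pairwise.sublist (List.dropWhile_sublist p)).imp fun {u v} huv hv => by
      simp only [hq, decide_eq_true_eq] at hv ⊢
      exact hv.trans huv.2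
  have hB : ∀ v ∈ T.dropWhile p, ((Y a l : ℝ) : EReal) < v.coord r Y l w l := fun v hv => by
    have := not_of_mem_dropWhile hpT v hv
    simpa [hp] using this
  have hA : ∀ v ∈ T.takeWhile p, v.coord r Y l w l < ((Y a l : ℝ) : EReal) := fun v hv => by
    have h1 := List.mem_takeWhile_imp hv
    have h2 := hne v ((List.takeWhile_sublist p).subset hv) l
    simp only [hp, decide_eq_true_eq] at h1
    exact lt_of_le_of_ne h1 h2
  have hfirst : Node.first ∈ T.takeWhile p := by
    have := hT.first_mem
    rw [hAB, List.mem_append] at this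
    refine this.resolve_right fun hb => ?_
    have := hB _ hb
    simp [Node.coord] at this
  have hlast : Node.last ∈ T.dropWhile p := by
    have := hT.last_mem
    rw [hAB, List.mem_append] at this
    refine this.resolve_left fun hb => ?_
    have := hA _ hb
    rw [Node.coord_last_of_ne hx.lw, EReal.coe_lt_coe_iff] at this
    exact absurd this (hY.lt_ref a l).not_gt
  have hlast2 : Node.last ∈ (T.dropWhile p).dropWhile q := by
    have := hlast
    rw [← List.takeWhile_append_dropWhile (p := q) (l := T.dropWhile p), List.mem_append] at this
    refine this.resolve_left fun hb => ?_
    have := List.mem_takeWhile_imp hb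
    simp [hq, Node.coord] at this
  obtain ⟨lo, d0, hlo⟩ : ∃ lo d0, T.takeWhile p = lo ++ [d0] := by
    rcases List.eq_nil_or_concat (T.takeWhile p) with h0 | ⟨lo, d0, h0⟩
    · rw [h0] at hfirst; simp at hfirst
    · exact ⟨lo, d0, by simpa using h0⟩
  obtain ⟨d1, up, hup⟩ : ∃ d1 up, (T.dropWhile p).dropWhile q = d1 :: up := by
    cases h0 : (T.dropWhile p).dropWhile q with
    | nil => rw [h0] at hlast2; simp at hlast2
    | cons d1 up => exact ⟨d1, up, rfl⟩
  have hd0 : d0 ∈ T.takeWhile p := by simp [hlo]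
  have hd0T : d0 ∈ T := (List.takeWhile_sublist p).subset hd0
  have hd1q : d1 ∈ (T.dropWhile p).dropWhile q := by simp [hup]
  have hd1 : d1 ∈ T.dropWhile p := (List.dropWhile_sublist q).subset hd1q
  have hd1T : d1 ∈ T := (List.dropWhile_sublist p).subset hd1
  refine ⟨lo, d0, (T.dropWhile p).takeWhile q, d1, up, ?_, ?_, ?_⟩
  · conv_lhs => rw [hAB, hlo, ← List.takeWhile_append_dropWhile (p := q) (l := T.dropWhile p), hup]
    simp
  · simp only [step]
    rw [← hp, ← hq, hlo, hup]
    simp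
  · refine ⟨hA _ hd0, ?_, hB _ hd1, ?_, fun v hv => hB v ((List.takeWhile_sublist q).subset hv),
      fun v hv => by simpa [hq] using List.mem_takeWhile_imp hv⟩
    · by_contra! hle
      have hlt := lt_of_le_of_ne hle (hne d0 hd0T w)
      have hl := hA _ hd0
      cases d0 with
      | first =>
        rw [Node.coord_first_of_ne hx.lw.symm, EReal.coe_lt_coe_iff] at hlt
        exact hlt.not_gt (hY.lt_ref a w)
      | last =>
        rw [Node.coord_last_of_ne hx.lw, EReal.coe_lt_coe_iff] at hl
        exact hl.not_gt (hY.lt_ref a l)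
      | point i =>
        simp only [Node.coord_point, EReal.coe_lt_coe_iff] at hl hlt
        have hh := ha i (hT.mem i hd0T)
        refine hY.not_dominates i a ⟨fun k => ?_, l, hl⟩
        rcases hx.exhaust k with rfl | rfl | rfl
        exacts [hl.le, hlt.le, hh.le]
    · have := not_of_mem_dropWhile hBq d1 hd1q
      simp only [hq, decide_eq_true_eq, not_lt] at this
      exact lt_of_le_of_ne this (hne d1 hd1T w)

theorem TreeInv.insert {L : Set (Fin n)} {lo inner up : List (Node n)} {d0 d1 : Node n}
    {a : Fin n} (hT : TreeInv r Y l w L (lo ++ d0 :: (inner ++ d1 :: up)))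
    (hd : Located r Y l w a d0 inner d1) :
    TreeInv r Y l w (Insert.insert a L) (lo ++ d0 :: .point a :: d1 :: up) := by
  have hpw := hT.pairwise
  have hsub : (lo ++ d0 :: d1 :: up).Sublist (lo ++ d0 :: (inner ++ d1 :: up)) := by
    simp
  refine ⟨?_, ?_, ?_, ?_, ?_⟩
  · have h1 := hpw.sublist hsub
    simp only [List.pairwise_append, List.pairwise_cons, List.mem_cons, Precedes] at h1 ⊢
    have e1 := hd.left_l; have e2 := hd.left_w; have e3 := hd.right_l; have e4 := hd.right_w
    obtain ⟨g1, ⟨g2, g3, g4⟩, g5⟩ := h1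
    refine ⟨g1, ⟨?_, ⟨?_, g3, g4⟩⟩, ?_⟩
    · rintro v (rfl | hv)
      · exact ⟨e1, e2⟩
      · exact g2 v hv
    · rintro v (rfl | hv)
      · exact ⟨e3, e4⟩
      · exact ⟨e3.trans (g3 v hv).1, (g3 v hv).2.trans e4⟩
    · rintro u hu v (rfl | rfl | hv)
      · exact g5 u hu _ (Or.inl rfl)
      · have := g5 u hu _ (Or.inl rfl)
        exact ⟨this.1.trans e1, e2.trans this.2⟩
      · exact g5 u hu v (Or.inr hv)
  · have hf := hT.first_mem
    simp only [List.mem_append, List.mem_cons, reduceCtorEq, false_or] at hf ⊢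
    have : Node.first ∉ inner := fun hv => by
      have := hd.inner_l _ hv
      simp [Node.coord] at this
    tauto
  · have hf := hT.last_mem
    simp only [List.mem_append, List.mem_cons, reduceCtorEq, false_or] at hf ⊢
    have : Node.last ∉ inner := fun hv => by
      have := hd.inner_w _ hv
      simp [Node.coord] at this
    tauto
  · intro i hi
    have := hT.mem i
    simp only [List.mem_append, List.mem_cons, Node.point.injEq, Set.mem_insert_iff] at hi this ⊢
    tauto
  · intro i hi
    rcases hi with rfl | hi
    · exact ⟨.point i, by simp, le_rfl, le_rfl⟩
    · obtain ⟨v, hv, h1, h2⟩ := hT.cover i hi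
      by_cases hin : v ∈ inner
      · exact ⟨.point a, by simp, ((hd.inner_l v hin).trans_le h1).le,
          ((hd.inner_w v hin).trans_le h2).le⟩
      · refine ⟨v, ?_, h1, h2⟩
        simp only [List.mem_append, List.mem_cons] at hv ⊢
        tauto

/-- What is known of an iteration in the sweep with axes `l`, `w`, `h`. -/
structure StepInv (r : Fin 3 → ℝ) (Y : Fin n → Fin 3 → ℝ) (l w h : Fin 3) (s : Step n) :
    Prop where
  l_eq : s.l = l
  w_eq : s.w = w
  h_eq : s.h = h
  located : Located r Y l w s.a s.left s.inner s.right
  pairwise : (s.left :: (s.inner ++ [s.right])).Pairwise (Precedes r Y l w)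
  mem : ∀ i, Node.point i ∈ s.left :: (s.inner ++ [s.right]) → Y i h < Y s.a h
  cover : ∀ i, Y i h < Y s.a h →
    s.left.coord r Y l w w ≤ ((Y i w : ℝ) : EReal) ∨
    s.right.coord r Y l w l ≤ ((Y i l : ℝ) : EReal) ∨
    ∃ v ∈ s.inner, v.coord r Y l w l ≤ ((Y i l : ℝ) : EReal) ∧
      v.coord r Y l w w ≤ ((Y i w : ℝ) : EReal)

theorem stepInv_of_mem_sweepFrom (hY : Generic r Y) (hx : Axes l w h) {as : List (Fin n)} :
    ∀ {T : List (Node n)} {L : Set (Fin n)}, TreeInv r Y l w L T →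
      as.Pairwise (fun i j => Y i h < Y j h) → (∀ j, j ∈ L ∨ j ∈ as) →
      (∀ j ∈ L, ∀ i ∈ as, Y j h < Y i h) →
      ∀ s ∈ sweepFrom r Y l w h T as, StepInv r Y l w h s := by
  induction as with
  | nil => simp [sweepFrom]
  | cons a as ih =>
    intro T L hT has hcov hL s hs
    obtain ⟨lo, d0, inner, d1, up, rfl, hstep, hd⟩ :=
      exists_step_eq hY hx hT (a := a) fun j hj => hL j hj a (by simp)
    rw [List.pairwise_cons] at has
    have hLa : ∀ j, Y j h < Y a h → j ∈ L := fun j hj => by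
      rcases hcov j with h1 | h1
      · exact h1
      · rcases List.mem_cons.1 h1 with rfl | h1
        · exact absurd hj (lt_irrefl _)
        · exact absurd (has.1 j h1) hj.not_gt
    simp only [sweepFrom, hstep, List.mem_cons] at hs
    rcases hs with rfl | hs
    · have hsub : (d0 :: (inner ++ [d1])).Sublist (lo ++ d0 :: (inner ++ d1 :: up)) := by
        refine List.Sublist.trans ?_ (List.sublist_append_right _ _)
        simp
      refine ⟨rfl, rfl, rfl, hd, hT.pairwise.sublist hsub, fun i hi => ?_, fun i hi => ?_⟩
      · exact hL i (hT.mem i (hsub.subset hi)) a (by simp)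
      · obtain ⟨v, hv, h1, h2⟩ := hT.cover i (hLa i hi)
        have hpw := hT.pairwise
        simp only [List.pairwise_append, List.pairwise_cons, List.mem_cons, List.mem_append,
          Precedes] at hpw hv
        obtain ⟨-, ⟨-, -, ⟨g3, -⟩, -⟩, g5⟩ := hpw
        rcases hv with hv | rfl | hv | rfl | hv
        · exact Or.inl ((g5 v hv d0 (Or.inl rfl)).2.le.trans h2)
        · exact Or.inl h2
        · exact Or.inr (Or.inr ⟨v, hv, h1, h2⟩)
        · exact Or.inr (Or.inl h1)
        · exact Or.inr (Or.inl ((g3 v hv).1.le.trans h1))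
    · refine ih (hT.insert hd) has.2 (fun j => ?_) (fun j hj i hi => ?_) s hs
      · rcases hcov j with h1 | h1
        · exact Or.inl (Or.inr h1)
        · rcases List.mem_cons.1 h1 with rfl | h1
          · exact Or.inl (Or.inl rfl)
          · exact Or.inr h1
      · rcases hj with rfl | hj
        · exact has.1 i hi
        · exact hL j hj i (by simp [hi])

theorem map_a_sweepFrom (as : List (Fin n)) : ∀ T : List (Node n),
    (sweepFrom r Y l w h T as).map Step.a = as := by
  induction as with
  | nil => simp [sweepFrom]
  | cons a as ih => intro T; simp [sweepFrom, step, ih]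

theorem pairwise_sorted (hY : Generic r Y) (h : Fin 3) :
    ((List.finRange n).mergeSort fun i j => decide (Y i h ≤ Y j h)).Pairwise
      fun i j => Y i h < Y j h := by
  have h1 : ((List.finRange n).mergeSort fun i j => decide (Y i h ≤ Y j h)).Pairwise
      fun i j => decide (Y i h ≤ Y j h) = true :=
    List.pairwise_mergeSort (fun a b c h1 h2 => by
      simp only [decide_eq_true_eq] at *
      exact h1.trans h2) (fun a b => by
      simpa using le_total _ _) _
  have h2 : ((List.finRange n).mergeSort fun i j => decide (Y i h ≤ Y j h)).Nodup :=
    (List.mergeSort_perm _ _).nodup_iff.2 (List.nodup_finRange n)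
  refine (h1.and h2).imp fun {i j} hij => ?_
  exact lt_of_le_of_ne (by simpa using hij.1) (hY.ne i j hij.2 h)

theorem stepInv_of_mem_sweep (hY : Generic r Y) (hx : Axes l w h) {s : Step n}
    (hs : s ∈ sweep r Y l w h) : StepInv r Y l w h s := by
  refine stepInv_of_mem_sweepFrom hY hx (T := [.first, .last]) (L := ∅) ?_
    (pairwise_sorted hY h) (by simp) (by simp) s hs
  refine ⟨?_, by simp, by simp, by simp, by simp⟩
  simp [Precedes, Node.coord, hx.lw, hx.lw.symm, EReal.bot_lt_coe]

theorem map_a_sweep : (sweep r Y l w h).map Step.a =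
    (List.finRange n).mergeSort fun i j => decide (Y i h ≤ Y j h) :=
  map_a_sweepFrom _ _

theorem exists_mem_sweep (r : Fin 3 → ℝ) (Y : Fin n → Fin 3 → ℝ) (l w h : Fin 3) (a : Fin n) :
    ∃ s ∈ sweep r Y l w h, s.a = a := by
  have : a ∈ (sweep r Y l w h).map Step.a := by rw [map_a_sweep]; simp
  simpa using this

theorem sweep_eq_of_a_eq {s t : Step n} (hs : s ∈ sweep r Y l w h) (ht : t ∈ sweep r Y l w h)
    (hst : s.a = t.a) : s = t := by
  refine List.inj_on_of_nodup_map ?_ hs ht hst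
  rw [map_a_sweep]
  exact (List.mergeSort_perm _ _).nodup_iff.2 (List.nodup_finRange n)

/-! ### The staircase of an iteration -/

/-- The node that determines the `m`-th vertical line of the polygon. -/
def Step.xNode (s : Step n) (m : ℕ) : Node n := if m = 0 then .point s.a else s.d m

/-- The node that determines the `m`-th horizontal line of the polygon. -/
def Step.zNode (s : Step n) (m : ℕ) : Node n := if m = s.N + 1 then .point s.a else s.d m

/-- The position of the `m`-th vertical line of the polygon. -/
def Step.x (r : Fin 3 → ℝ) (Y : Fin n → Fin 3 → ℝ) (s : Step n) (m : ℕ) : ℝ :=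
  ((s.xNode m).coord r Y s.l s.w s.l).toReal

/-- The position of the `m`-th horizontal line of the polygon. -/
def Step.z (r : Fin 3 → ℝ) (Y : Fin n → Fin 3 → ℝ) (s : Step n) (m : ℕ) : ℝ :=
  ((s.zNode m).coord r Y s.l s.w s.w).toReal

@[simp] theorem Step.x_zero (s : Step n) : s.x r Y 0 = Y s.a s.l := rfl

@[simp] theorem Step.x_succ (s : Step n) (m : ℕ) : s.x r Y (m + 1) = s.dl r Y (m + 1) := by
  simp [Step.x, Step.xNode, Step.dl]

@[simp] theorem Step.z_last (s : Step n) : s.z r Y (s.N + 1) = Y s.a s.w := by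
  simp [Step.z, Step.zNode]

theorem Step.z_of_le (s : Step n) {m : ℕ} (hm : m ≤ s.N) : s.z r Y m = s.dw r Y m := by
  simp [Step.z, Step.zNode, Step.dw, show m ≠ s.N + 1 by omega]

theorem Step.d_zero (s : Step n) : s.d 0 = s.left := rfl

theorem Step.d_last (s : Step n) : s.d (s.N + 1) = s.right := by
  simp [Step.d, Step.N]

theorem Step.d_mem_inner (s : Step n) {m : ℕ} (h1 : m + 1 ≤ s.N) : s.d (m + 1) ∈ s.inner := by
  have : m < s.inner.length := h1
  simp [Step.d, List.getElem?_append_left this, List.getElem?_eq_getElem this]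

theorem Step.exists_d_of_mem_inner (s : Step n) {v : Node n} (hv : v ∈ s.inner) :
    ∃ m, m + 1 ≤ s.N ∧ s.d (m + 1) = v := by
  obtain ⟨m, hm, rfl⟩ := List.getElem_of_mem hv
  exact ⟨m, hm, by simp [Step.d, List.getElem?_append_left hm, List.getElem?_eq_getElem hm]⟩

theorem Step.d_eq_getElem (s : Step n) {m : ℕ} (hm : m ≤ s.N + 1) :
    s.d m = (s.left :: (s.inner ++ [s.right]))[m]'(by simp [Step.N] at hm ⊢; omega) := by
  rw [Step.d, List.getD_eq_getElem]

theorem Step.d_mem (s : Step n) {m : ℕ} (hm : m ≤ s.N + 1) :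
    s.d m ∈ s.left :: (s.inner ++ [s.right]) := by
  rw [s.d_eq_getElem hm]
  exact List.getElem_mem _

theorem Node.coe_coord_l (hx : Axes l w h) {v : Node n} (hv : v ≠ .first) :
    (((v.coord r Y l w l).toReal : ℝ) : EReal) = v.coord r Y l w l := by
  cases v with
  | first => exact absurd rfl hv
  | last => rw [Node.coord_last_of_ne hx.lw, EReal.toReal_coe]
  | point i => rfl

theorem Node.coe_coord_w (hx : Axes l w h) {v : Node n} (hv : v ≠ .last) :
    (((v.coord r Y l w w).toReal : ℝ) : EReal) = v.coord r Y l w w := by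
  cases v with
  | last => exact absurd rfl hv
  | first => rw [Node.coord_first_of_ne hx.lw.symm, EReal.toReal_coe]
  | point i => rfl

theorem Node.ne_first {v : Node n} {a : ℝ} (hv : (a : EReal) < v.coord r Y l w l) :
    v ≠ .first := by
  rintro rfl
  simp [Node.coord] at hv

theorem Node.ne_last {v : Node n} {a : ℝ} (hv : (a : EReal) < v.coord r Y l w w) :
    v ≠ .last := by
  rintro rfl
  simp [Node.coord] at hv

/-- The geometry of an iteration in terms of real numbers. -/
structure Staircase (r : Fin 3 → ℝ) (Y : Fin n → Fin 3 → ℝ) (l w h : Fin 3) (s : Step n) :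
    Prop where
  l_eq : s.l = l
  w_eq : s.w = w
  h_eq : s.h = h
  x_lt : ∀ i j, i < j → j ≤ s.N + 1 → s.x r Y i < s.x r Y j
  z_lt : ∀ i j, i < j → j ≤ s.N + 1 → s.z r Y j < s.z r Y i
  x_le_ref : s.x r Y (s.N + 1) ≤ r l
  z_le_ref : s.z r Y 0 ≤ r w
  mem : ∀ i m, m ≤ s.N + 1 → s.d m = .point i → Y i h < Y s.a h
  left : (s.d 0 = .first ∧ s.z r Y 0 = r w) ∨ ∃ j, s.d 0 = .point j ∧ Y j l < Y s.a l
  right : (s.d (s.N + 1) = .last ∧ s.x r Y (s.N + 1) = r l) ∨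
    ∃ j, s.d (s.N + 1) = .point j ∧ Y j w < Y s.a w
  inner : ∀ m, m + 1 ≤ s.N → ∃ j, s.d (m + 1) = .point j
  cover : ∀ i, Y i h < Y s.a h → s.z r Y 0 ≤ Y i w ∨ s.x r Y (s.N + 1) ≤ Y i l ∨
    ∃ m, m + 1 ≤ s.N ∧ s.x r Y (m + 1) ≤ Y i l ∧ s.z r Y (m + 1) ≤ Y i w

theorem StepInv.staircase (hY : Generic r Y) (hx : Axes l w h) {s : Step n}
    (hs : StepInv r Y l w h s) : Staircase r Y l w h s := by
  obtain ⟨rfl, rfl, rfl, hl, hp, hm, hc⟩ := hs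
  have hpos_l : ∀ m, m + 1 ≤ s.N + 1 →
      ((Y s.a s.l : ℝ) : EReal) < (s.d (m + 1)).coord r Y s.l s.w s.l := fun m hm1 => by
    rcases Nat.lt_or_ge m s.N with h1 | h1
    · exact hl.inner_l _ (s.d_mem_inner h1)
    · obtain rfl : m = s.N := by omega
      rw [s.d_last]; exact hl.right_l
  have hpos_w : ∀ m, m ≤ s.N →
      ((Y s.a s.w : ℝ) : EReal) < (s.d m).coord r Y s.l s.w s.w := fun m hm1 => by
    cases m with
    | zero => exact hl.left_w
    | succ m => exact hl.inner_w _ (s.d_mem_inner hm1)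
  have hX : ∀ m, m + 1 ≤ s.N + 1 → ((s.x r Y (m + 1) : ℝ) : EReal) =
      (s.d (m + 1)).coord r Y s.l s.w s.l := fun m hm1 => by
    rw [Step.x_succ]
    exact Node.coe_coord_l hx (Node.ne_first (hpos_l m hm1))
  have hZ : ∀ m, m ≤ s.N → ((s.z r Y m : ℝ) : EReal) =
      (s.d m).coord r Y s.l s.w s.w := fun m hm1 => by
    rw [Step.z_of_le s hm1]
    exact Node.coe_coord_w hx (Node.ne_last (hpos_w m hm1))
  have hpair : ∀ i j, i < j → j ≤ s.N + 1 → Precedes r Y s.l s.w (s.d i) (s.d j) :=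
    fun i j hij hj => by
      rw [s.d_eq_getElem hj, s.d_eq_getElem (hij.le.trans hj)]
      exact List.pairwise_iff_getElem.1 hp _ _ _ _ hij
  refine ⟨rfl, rfl, rfl, ?_, ?_, ?_, ?_, ?_, ?_, ?_, ?_, ?_⟩
  · intro i j hij hj
    obtain ⟨j, rfl⟩ : ∃ k, j = k + 1 := ⟨j - 1, by omega⟩
    rw [← EReal.coe_lt_coe_iff, hX j hj]
    cases i with
    | zero => exact hpos_l j hj
    | succ i => rw [hX i (by omega)]; exact (hpair _ _ hij hj).1
  · intro i j hij hj
    rw [← EReal.coe_lt_coe_iff, hZ i (by omega)]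
    rcases Nat.lt_or_ge j (s.N + 1) with h1 | h1
    · rw [hZ j (by omega)]; exact (hpair _ _ hij hj).2
    · obtain rfl : j = s.N + 1 := by omega
      rw [Step.z_last]
      exact hpos_w i (by omega)
  · have h1 := hX s.N le_rfl
    rw [s.d_last] at h1
    cases hr : s.right with
    | first => exact absurd hr (Node.ne_first hl.right_l)
    | last =>
      rw [hr, Node.coord_last_of_ne hx.lw] at h1
      exact (EReal.coe_injective h1).le
    | point i =>
      rw [hr, Node.coord_point] at h1
      exact (EReal.coe_injective h1).trans_le (hY.lt_ref i _).le
  · have h1 := hZ 0 (by omega)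
    rw [s.d_zero] at h1
    cases hr : s.left with
    | last => exact absurd hr (Node.ne_last hl.left_w)
    | first =>
      rw [hr, Node.coord_first_of_ne hx.lw.symm] at h1
      exact (EReal.coe_injective h1).le
    | point i =>
      rw [hr, Node.coord_point] at h1
      exact (EReal.coe_injective h1).trans_le (hY.lt_ref i _).le
  · intro i m hm1 hi
    exact hm i (hi ▸ s.d_mem hm1)
  · have h1 := hZ 0 (by omega)
    have h2 := hl.left_l
    rw [s.d_zero] at h1 ⊢
    cases hr : s.left with
    | last => exact absurd hr (Node.ne_last hl.left_w)
    | first =>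
      rw [hr, Node.coord_first_of_ne hx.lw.symm] at h1
      exact Or.inl ⟨rfl, EReal.coe_injective h1⟩
    | point i =>
      rw [hr, Node.coord_point, EReal.coe_lt_coe_iff] at h2
      exact Or.inr ⟨i, rfl, h2⟩
  · have h1 := hX s.N le_rfl
    have h2 := hl.right_w
    rw [s.d_last] at h1 ⊢
    cases hr : s.right with
    | first => exact absurd hr (Node.ne_first hl.right_l)
    | last =>
      rw [hr, Node.coord_last_of_ne hx.lw] at h1
      exact Or.inl ⟨rfl, EReal.coe_injective h1⟩
    | point i =>
      rw [hr, Node.coord_point, EReal.coe_lt_coe_iff] at h2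
      exact Or.inr ⟨i, rfl, h2⟩
  · intro m hm1
    have h1 := Node.ne_first (hl.inner_l _ (s.d_mem_inner hm1))
    have h2 := Node.ne_last (hl.inner_w _ (s.d_mem_inner hm1))
    cases hd : s.d (m + 1) with
    | first => exact absurd hd h1
    | last => exact absurd hd h2
    | point j => exact ⟨j, rfl⟩
  · intro i hi
    rcases hc i hi with h1 | h1 | ⟨v, hv, h1, h2⟩
    · left
      rwa [← EReal.coe_le_coe_iff, hZ 0 (by omega)]
    · right; left
      rwa [← EReal.coe_le_coe_iff, hX s.N le_rfl, s.d_last]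
    · obtain ⟨m, hm1, rfl⟩ := s.exists_d_of_mem_inner hv
      right; right
      refine ⟨m, hm1, ?_, ?_⟩
      · rwa [← EReal.coe_le_coe_iff, hX m (by omega)]
      · rwa [← EReal.coe_le_coe_iff, hZ _ hm1]

theorem staircase_of_mem_sweep (hY : Generic r Y) (hx : Axes l w h) {s : Step n}
    (hs : s ∈ sweep r Y l w h) : Staircase r Y l w h s :=
  (stepInv_of_mem_sweep hY hx hs).staircase hY hx

theorem Staircase.x_le {s : Step n} (hs : Staircase r Y l w h s) {i j : ℕ} (hij : i ≤ j)
    (hj : j ≤ s.N + 1) : s.x r Y i ≤ s.x r Y j := by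
  rcases hij.eq_or_lt with rfl | hij
  · exact le_rfl
  · exact (hs.x_lt i j hij hj).le

theorem Staircase.z_le {s : Step n} (hs : Staircase r Y l w h s) {i j : ℕ} (hij : i ≤ j)
    (hj : j ≤ s.N + 1) : s.z r Y j ≤ s.z r Y i := by
  rcases hij.eq_or_lt with rfl | hij
  · exact le_rfl
  · exact (hs.z_lt i j hij hj).le

/-- The part of the `lw`-plane newly dominated by the processed point consists of the
rectangles between consecutive vertical lines. -/
theorem Staircase.region_iff {s : Step n} (hs : Staircase r Y l w h s)
    (p q : ℝ) :
    (Y s.a l ≤ p ∧ Y s.a w ≤ q ∧ p < r l ∧ q < r w ∧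
      ∀ j, Y j h < Y s.a h → ¬ (Y j l ≤ p ∧ Y j w ≤ q)) ↔
    ∃ m ≤ s.N, (s.x r Y m ≤ p ∧ p < s.x r Y (m + 1)) ∧ (Y s.a w ≤ q ∧ q < s.z r Y m) := by
  obtain ⟨rfl, rfl, rfl⟩ := And.intro hs.l_eq (And.intro hs.w_eq hs.h_eq)
  constructor
  · rintro ⟨h1, h2, h3, h4, h5⟩
    have hpN : p < s.x r Y (s.N + 1) := by
      rcases hs.right with ⟨-, h6⟩ | ⟨j, h6, h7⟩
      · rwa [h6]
      · by_contra! h8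
        refine h5 j (hs.mem j _ le_rfl h6) ⟨?_, h7.le.trans h2⟩
        simpa [Step.x_succ, Step.dl, h6] using h8
    have hex : ∃ m, p < s.x r Y (m + 1) := ⟨s.N, hpN⟩
    classical
    have hmin := fun k => Nat.find_min hex (m := k)
    have hspec := Nat.find_spec hex
    have hle : Nat.find hex ≤ s.N := Nat.find_le hpN
    set m := Nat.find hex
    have hmp : s.x r Y m ≤ p := by
      cases hm : m with
      | zero => simpa using h1
      | succ k => exact not_lt.1 (hmin k (by omega))
    refine ⟨m, hle, ⟨hmp, hspec⟩, h2, ?_⟩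
    by_contra! h8
    clear_value m
    cases m with
    | zero =>
      rcases hs.left with ⟨-, h6⟩ | ⟨j, h6, h7⟩
      · exact absurd h4 (h6 ▸ h8).not_gt
      · refine h5 j (hs.mem j _ (by omega) h6) ⟨h7.le.trans h1, ?_⟩
        simpa [Step.z_of_le, Step.dw, h6] using h8
    | succ k =>
      obtain ⟨j, hj⟩ := hs.inner k hle
      refine h5 j (hs.mem j _ (by omega) hj) ⟨?_, ?_⟩
      · simpa [Step.x_succ, Step.dl, hj] using hmp
      · simpa [Step.z_of_le s hle, Step.dw, hj] using h8
  · rintro ⟨m, hm, ⟨h1, h2⟩, h3, h4⟩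
    refine ⟨?_, h3, ?_, ?_, fun i hi hip => ?_⟩
    · exact (s.x_zero (r := r) (Y := Y)).symm.trans_le ((hs.x_le (Nat.zero_le m) (by omega)).trans h1)
    · exact h2.trans_le ((hs.x_le (by omega) le_rfl).trans hs.x_le_ref)
    · exact h4.trans_le ((hs.z_le (Nat.zero_le m) (by omega)).trans hs.z_le_ref)
    · rcases hs.cover i hi with h5 | h5 | ⟨k, hk, h5, h6⟩
      · have := hs.z_le (Nat.zero_le m) (by omega)
        linarith [hip.2]
      · have := hs.x_le (show m + 1 ≤ s.N + 1 by omega) le_rfl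
        linarith [hip.1]
      · rcases Nat.lt_or_ge m (k + 1) with h7 | h7
        · have := hs.x_le (show m + 1 ≤ k + 1 by omega) (by omega)
          linarith [hip.1]
        · have := hs.z_le h7 (by omega)
          linarith [hip.2]

/-! ### The hypervolume as a sum of prisms -/

theorem Axes.prod {M : Type*} [CommMonoid M] (hx : Axes l w h) (f : Fin 3 → M) :
    ∏ k, f k = f l * (f w * f h) := by
  have : (Finset.univ : Finset (Fin 3)) = {l, w, h} := by
    ext k; simpa using hx.exhaust k
  rw [this, Finset.prod_insert (by simp [hx.lw, hx.lh]), Finset.prod_insert (by simp [hx.wh]),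
    Finset.prod_singleton]

/-- The axis-parallel half-open box with given extents along the axes `l`, `w`, `h`. -/
def box (l w h : Fin 3) (x x' z z' y y' : ℝ) : Set (Fin 3 → ℝ) :=
  {p | (x ≤ p l ∧ p l < x') ∧ (z ≤ p w ∧ p w < z') ∧ (y ≤ p h ∧ p h < y')}

theorem Axes.box_eq (hx : Axes l w h) (x x' z z' y y' : ℝ) :
    box l w h x x' z z' y y' = Set.pi Set.univ fun k =>
      Set.Ico (if k = l then x else if k = w then z else y)
        (if k = l then x' else if k = w then z' else y') := by
  ext p
  simp only [box, Set.mem_ofPred_eq, Set.mem_pi, Set.mem_univ, true_imp_iff, Set.mem_Ico]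
  constructor
  · rintro ⟨h1, h2, h3⟩ k
    rcases hx.exhaust k with rfl | rfl | rfl
    · simpa using h1
    · simpa [hx.lw.symm] using h2
    · simpa [hx.lh.symm, hx.wh.symm] using h3
  · intro H
    exact ⟨by simpa using H l, by simpa [hx.lw.symm] using H w,
      by simpa [hx.lh.symm, hx.wh.symm] using H h⟩

theorem Axes.measurableSet_box (hx : Axes l w h) (x x' z z' y y' : ℝ) :
    MeasurableSet (box l w h x x' z z' y y') := by
  rw [hx.box_eq]
  exact MeasurableSet.univ_pi fun _ => measurableSet_Ico

theorem Axes.volume_box_ne_top (hx : Axes l w h) (x x' z z' y y' : ℝ) :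
    volume (box l w h x x' z z' y y') ≠ ⊤ := by
  rw [hx.box_eq, Real.volume_pi_Ico]
  exact (ENNReal.prod_lt_top fun _ _ => ENNReal.ofReal_lt_top).ne

theorem Axes.volume_real_box (hx : Axes l w h) {x x' z z' y y' : ℝ} (h1 : x ≤ x') (h2 : z ≤ z')
    (h3 : y ≤ y') :
    volume.real (box l w h x x' z z' y y') = (x' - x) * ((z' - z) * (y' - y)) := by
  rw [hx.box_eq, Measure.real, Real.volume_pi_Ico_toReal, hx.prod]
  · simp [hx.lw.symm, hx.lh.symm, hx.wh.symm]
  · intro k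
    dsimp only
    split_ifs <;> assumption

/-- The area of the polygon swept in an iteration. -/
def Step.area (r : Fin 3 → ℝ) (Y : Fin n → Fin 3 → ℝ) (s : Step n) : ℝ :=
  ∑ m ∈ Finset.range (s.N + 1), (s.x r Y (m + 1) - s.x r Y m) * (s.z r Y m - s.z r Y (s.N + 1))

theorem ae_dominated_eq (r : Fin 3 → ℝ) (Y : Fin n → Fin 3 → ℝ) :
    {p : Fin 3 → ℝ | ∃ y ∈ Set.range Y, Dominates y p ∧ Dominates p r} =ᵐ[volume]
      {p | ∃ i, (∀ k, Y i k ≤ p k) ∧ ∀ k, p k < r k} := by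
  have h0 : ∀ (k : Fin 3) (c : ℝ), ∀ᵐ p : Fin 3 → ℝ, p k ≠ c := fun k c => by
    rw [volume_pi]
    exact Measure.ae_eval_ne (α := fun _ : Fin 3 => ℝ) _ k c
  have h1 : ∀ᵐ p : Fin 3 → ℝ, ∀ k, p k ≠ r k := ae_all_iff.2 fun k => h0 k (r k)
  have h2 : ∀ᵐ p : Fin 3 → ℝ, ∀ i : Fin n, p 0 ≠ Y i 0 := ae_all_iff.2 fun i => h0 0 (Y i 0)
  filter_upwards [h1, h2] with p h1 h2
  refine propext ⟨?_, ?_⟩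
  · rintro ⟨_, ⟨i, rfl⟩, h3, h4⟩
    exact ⟨i, h3.1, fun k => lt_of_le_of_ne (h4.1 k) (h1 k)⟩
  · rintro ⟨i, h3, h4⟩
    exact ⟨_, ⟨i, rfl⟩, ⟨h3, 0, lt_of_le_of_ne (h3 0) (h2 i).symm⟩, fun k => (h4 k).le, 0, h4 0⟩

/-- The prism over a rectangle of the polygon of an iteration. -/
def Step.prism (r : Fin 3 → ℝ) (Y : Fin n → Fin 3 → ℝ) (l w h : Fin 3) (s : Step n) (m : ℕ) :
    Set (Fin 3 → ℝ) :=
  box l w h (s.x r Y m) (s.x r Y (m + 1)) (Y s.a w) (s.z r Y m) (Y s.a h) (r h)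

theorem dominated_eq_iUnion_prism (hY : Generic r Y) (hx : Axes l w h) {S : Fin n → Step n}
    (hS : ∀ a, S a ∈ sweep r Y l w h) (hSa : ∀ a, (S a).a = a) :
    {p : Fin 3 → ℝ | ∃ i, (∀ k, Y i k ≤ p k) ∧ ∀ k, p k < r k} =
      ⋃ b ∈ Finset.univ.sigma fun a => Finset.range ((S a).N + 1),
        (S b.1).prism r Y l w h b.2 := by
  have hst := fun a => staircase_of_mem_sweep hY hx (hS a)
  ext p
  simp only [Set.mem_ofPred_eq, Set.mem_iUnion, Finset.mem_sigma, Finset.mem_univ, true_and,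
    Finset.mem_range, Sigma.exists, Step.prism, box, exists_prop]
  constructor
  · rintro ⟨i, h1, h2⟩
    classical
    obtain ⟨a, ha, hmin⟩ := Finset.exists_min_image
      (Finset.univ.filter fun j => Y j l ≤ p l ∧ Y j w ≤ p w) (fun j => Y j h)
      ⟨i, by simp [h1]⟩
    simp only [Finset.mem_filter, Finset.mem_univ, true_and] at ha hmin
    obtain ⟨m, hm, h3, h4⟩ := ((hst a).region_iff (p l) (p w)).1 (by
      rw [hSa]
      exact ⟨ha.1, ha.2, h2 l, h2 w, fun j hj hjp => (hmin j hjp).not_gt hj⟩)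
    refine ⟨a, m, by omega, h3, h4, ?_, h2 h⟩
    rw [hSa]
    exact (hmin i ⟨h1 l, h1 w⟩).trans (h1 h)
  · rintro ⟨a, m, hm, h3, h4, h5, h6⟩
    obtain ⟨h7, h8, h9, h10, -⟩ :=
      ((hst a).region_iff (p l) (p w)).2 ⟨m, by omega, h3, h4⟩
    rw [hSa] at h5 h7 h8
    refine ⟨a, fun k => ?_, fun k => ?_⟩ <;> rcases hx.exhaust k with rfl | rfl | rfl <;>
      assumption

theorem pairwiseDisjoint_prism (hY : Generic r Y) (hx : Axes l w h) {S : Fin n → Step n}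
    (hS : ∀ a, S a ∈ sweep r Y l w h) (hSa : ∀ a, (S a).a = a) :
    Set.PairwiseDisjoint
      (↑(Finset.univ.sigma fun a => Finset.range ((S a).N + 1)) : Set (Σ _ : Fin n, ℕ))
      fun b => (S b.1).prism r Y l w h b.2 := by
  have hst := fun a => staircase_of_mem_sweep hY hx (hS a)
  have hreg : ∀ (p : Fin 3 → ℝ) a m, m ≤ (S a).N → p ∈ (S a).prism r Y l w h m →
      Y a l ≤ p l ∧ Y a w ≤ p w ∧ ∀ j, Y j h < Y a h → ¬ (Y j l ≤ p l ∧ Y j w ≤ p w) := by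
    intro p a m hm hp
    have := ((hst a).region_iff (p l) (p w)).2 ⟨m, hm, hp.1, hp.2.1⟩
    rw [hSa] at this
    exact ⟨this.1, this.2.1, this.2.2.2.2⟩
  rintro ⟨a, m⟩ hm ⟨b, k⟩ hk hne
  simp only [Finset.coe_sigma, Set.mem_sigma_iff, Finset.mem_coe, Finset.mem_univ,
    Finset.mem_range, true_and] at hm hk
  refine Set.disjoint_left.2 fun p hp hp' => ?_
  dsimp only at hp hp'
  have ha := hreg p a m (by omega) hp
  have hb := hreg p b k (by omega) hp'
  rcases eq_or_ne a b with rfl | hab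
  · have hmk : m ≠ k := fun e => hne (by rw [e])
    have h1 := hp.1
    have h2 := hp'.1
    rcases lt_or_gt_of_ne hmk with h3 | h3
    · have := (hst a).x_le (show m + 1 ≤ k by omega) (by omega)
      linarith
    · have := (hst a).x_le (show k + 1 ≤ m by omega) (by omega)
      linarith
  · rcases lt_or_gt_of_ne (hY.ne a b hab h) with h3 | h3
    · exact hb.2.2 a h3 ⟨ha.1, ha.2.1⟩
    · exact ha.2.2 b h3 ⟨hb.1, hb.2.1⟩

theorem HV_eq_sum_prism (hY : Generic r Y) (hx : Axes l w h) {S : Fin n → Step n}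
    (hS : ∀ a, S a ∈ sweep r Y l w h) (hSa : ∀ a, (S a).a = a) :
    HV r (Set.range Y) = ∑ a, (r h - Y a h) * (S a).area r Y := by
  have hst := fun a => staircase_of_mem_sweep hY hx (hS a)
  rw [HV, measure_congr (ae_dominated_eq r Y), dominated_eq_iUnion_prism hY hx hS hSa,
    ← Measure.real, measureReal_biUnion_finset (pairwiseDisjoint_prism hY hx hS hSa)
      (fun b _ => hx.measurableSet_box _ _ _ _ _ _) (fun b _ => hx.volume_box_ne_top _ _ _ _ _ _),
    Finset.sum_sigma]
  refine Finset.sum_congr rfl fun a _ => ?_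
  rw [Step.area, Finset.mul_sum]
  refine Finset.sum_congr rfl fun m hm => ?_
  have hm' : m ≤ (S a).N := by rw [Finset.mem_range] at hm; omega
  have hz := ((hst a).z_lt m ((S a).N + 1) (by omega) le_rfl).le
  rw [Step.z_last, (hst a).w_eq, hSa] at hz
  dsimp only [Step.prism]
  rw [hx.volume_real_box, Step.z_last, (hst a).w_eq, hSa]
  · ring
  · exact (hst a).x_le (by omega) (by omega)
  · rwa [hSa]
  · rw [hSa]; exact (hY.lt_ref a h).le

/-! ### The sweep depends only on the order of the coordinates -/

/-- `Y'` has the same coordinatewise order as `Y`. -/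
structure SameOrder (r : Fin 3 → ℝ) (Y Y' : Fin n → Fin 3 → ℝ) : Prop where
  le_iff : ∀ i j k, Y' i k ≤ Y' j k ↔ Y i k ≤ Y j k
  le_ref_iff : ∀ i k, r k ≤ Y' i k ↔ r k ≤ Y i k

theorem SameOrder.coord_le_iff {Y' : Fin n → Fin 3 → ℝ} (hY : SameOrder r Y Y') (v : Node n)
    (a : Fin n) (c : Fin 3) :
    v.coord r Y' l w c ≤ ((Y' a c : ℝ) : EReal) ↔ v.coord r Y l w c ≤ ((Y a c : ℝ) : EReal) := by
  cases v with
  | first => by_cases hc : c = l <;> simp [Node.coord, hc, hY.le_ref_iff]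
  | last => by_cases hc : c = w <;> simp [Node.coord, hc, hY.le_ref_iff]
  | point i => simp [hY.le_iff]

theorem SameOrder.step_eq {Y' : Fin n → Fin 3 → ℝ} (hY : SameOrder r Y Y') :
    step r Y' l w h = step r Y l w h := by
  funext T a
  simp only [step, ← not_le, hY.coord_le_iff]

theorem SameOrder.sweep_eq {Y' : Fin n → Fin 3 → ℝ} (hY : SameOrder r Y Y') :
    sweep r Y' l w h = sweep r Y l w h := by
  have : ∀ as T, sweepFrom r Y' l w h T as = sweepFrom r Y l w h T as := by
    intro as
    induction as with
    | nil => intro T; rfl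
    | cons a as ih => intro T; simp only [sweepFrom, hY.step_eq, ih]
  simp only [sweep, hY.le_iff, this]

theorem SameOrder.generic {Y' : Fin n → Fin 3 → ℝ} (h : SameOrder r Y Y') (hY : Generic r Y) :
    Generic r Y' where
  not_dominates i j hd := hY.not_dominates i j
    ⟨fun k => (h.le_iff i j k).1 (hd.1 k), hd.2.imp fun k hk => by
      rw [← not_le, ← h.le_iff, not_le]; exact hk⟩
  ne i j hij k he := hY.ne i j hij k
    (le_antisymm ((h.le_iff i j k).1 he.le) ((h.le_iff j i k).1 he.ge))
  lt_ref i k := by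
    rw [← not_le, h.le_ref_iff, not_le]; exact hY.lt_ref i k

theorem eventually_sameOrder (hY : Generic r Y) :
    ∀ᶠ V in nhds (concat Y), SameOrder r Y fun i k => V (i, k) := by
  have h1 : ∀ i k, ∀ᶠ V in nhds (concat Y), V (i, k) < r k := fun i k =>
    (continuous_apply (i, k)).continuousAt.eventually_lt continuousAt_const (hY.lt_ref i k)
  have h2 : ∀ i j k, Y i k < Y j k → ∀ᶠ V in nhds (concat Y), V (i, k) < V (j, k) :=
    fun i j k hij => (continuous_apply (i, k)).continuousAt.eventually_lt
      (continuous_apply (j, k)).continuousAt hij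
  have h3 : ∀ᶠ V in nhds (concat Y), ∀ i k, V (i, k) < r k :=
    Filter.eventually_all.2 fun i => Filter.eventually_all.2 fun k => h1 i k
  have h4 : ∀ᶠ V in nhds (concat Y), ∀ i j k, Y i k < Y j k → V (i, k) < V (j, k) :=
    Filter.eventually_all.2 fun i => Filter.eventually_all.2 fun j =>
      Filter.eventually_all.2 fun k => Filter.eventually_imp_distrib_left.2 (h2 i j k)
  filter_upwards [h3, h4] with V h3 h4
  refine ⟨fun i j k => ?_, fun i k => ?_⟩
  · rcases eq_or_ne i j with rfl | hij
    · simp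
    · rcases lt_or_gt_of_ne (hY.ne i j hij k) with h5 | h5
      · exact iff_of_true (h4 i j k h5).le h5.le
      · exact iff_of_false (h4 j i k h5).not_ge h5.not_ge
  · exact iff_of_false (h3 i k).not_ge (hY.lt_ref i k).not_ge

/-- Near `Y` the hypervolume indicator is a polynomial. -/
theorem eventuallyEq_sum_prism (hY : Generic r Y) (hx : Axes l w h) {S : Fin n → Step n}
    (hS : ∀ a, S a ∈ sweep r Y l w h) (hSa : ∀ a, (S a).a = a) :
    hypervolume r =ᶠ[nhds (concat Y)] fun V =>
      ∑ a, (r h - V (a, h)) * (S a).area r fun i k => V (i, k) := by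
  filter_upwards [eventually_sameOrder hY] with V hV
  exact HV_eq_sum_prism (hV.generic hY) hx (fun a => by rw [hV.sweep_eq]; exact hS a) hSa

/-! ### Derivatives -/

/-- The partial derivative of the coordinate `c` of a node with respect to the variable `q`. -/
def Node.delta (v : Node n) (c : Fin 3) (q : Fin n × Fin 3) : ℝ :=
  match v with
  | .point i => if (i, c) = q then 1 else 0
  | _ => 0

theorem Node.delta_eq_zero (v : Node n) {c : Fin 3} {q : Fin n × Fin 3} (hc : q.2 ≠ c) :
    v.delta c q = 0 := by
  cases v with
  | point i => exact if_neg fun (e : (i, c) = q) => hc (e ▸ rfl)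
  | _ => rfl

theorem Node.delta_of_eq {v : Node n} {c : Fin 3} {q : Fin n × Fin 3} (hv : v = .point q.1)
    (hc : q.2 = c) : v.delta c q = 1 := by
  subst hv hc
  simp [Node.delta]

theorem Node.delta_of_ne {v : Node n} {c : Fin 3} {q : Fin n × Fin 3} (hv : v ≠ .point q.1) :
    v.delta c q = 0 := by
  cases v with
  | point i => exact if_neg fun (e : (i, c) = q) => hv (e ▸ rfl)
  | _ => rfl

theorem Node.eq_of_delta_ne_zero {v : Node n} {c : Fin 3} {q : Fin n × Fin 3}
    (hv : v.delta c q ≠ 0) : v = .point q.1 ∧ q.2 = c :=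
  ⟨not_not.1 fun e => hv (Node.delta_of_ne e), not_not.1 fun e => hv (v.delta_eq_zero e)⟩

theorem Node.coord_add_smul_single (V : Fin n × Fin 3 → ℝ) (q : Fin n × Fin 3) (t : ℝ)
    (v : Node n) (c : Fin 3) :
    (v.coord r (fun i k => (V + t • Pi.single q 1 : Fin n × Fin 3 → ℝ) (i, k)) l w c).toReal =
      (v.coord r (fun i k => V (i, k)) l w c).toReal + t * v.delta c q := by
  cases v with
  | point i => simp [Node.delta, Pi.single_apply, -EReal.coe_add]
  | first => simp [Node.delta, Node.coord]
  | last => simp [Node.delta, Node.coord]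

theorem Node.contDiff_coord (v : Node n) (c : Fin 3) :
    ContDiff ℝ 2 fun V : Fin n × Fin 3 → ℝ =>
      (v.coord r (fun i k => V (i, k)) l w c).toReal := by
  cases v with
  | point i => exact contDiff_apply ℝ ℝ (ι := Fin n × Fin 3) (i, c)
  | first => exact contDiff_const (c := (Node.coord r 0 l w (.first : Node n) c).toReal)
  | last => exact contDiff_const (c := (Node.coord r 0 l w (.last : Node n) c).toReal)

theorem Step.contDiff_area (s : Step n) :
    ContDiff ℝ 2 fun V : Fin n × Fin 3 → ℝ => s.area r fun i k => V (i, k) :=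
  ContDiff.sum fun _ _ => ((Node.contDiff_coord _ _).sub (Node.contDiff_coord _ _)).mul
    ((Node.contDiff_coord _ _).sub (Node.contDiff_coord _ _))

/-- The partial derivative of the area of the polygon with respect to the variable `q`. -/
def Step.darea (r : Fin 3 → ℝ) (Y : Fin n → Fin 3 → ℝ) (s : Step n) (q : Fin n × Fin 3) : ℝ :=
  ∑ m ∈ Finset.range (s.N + 1),
    (((s.xNode (m + 1)).delta s.l q - (s.xNode m).delta s.l q) *
        (s.z r Y m - s.z r Y (s.N + 1)) +
      (s.x r Y (m + 1) - s.x r Y m) *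
        ((s.zNode m).delta s.w q - (s.zNode (s.N + 1)).delta s.w q))

theorem Step.area_add_smul_single (s : Step n) (hlw : s.l ≠ s.w) (V : Fin n × Fin 3 → ℝ)
    (q : Fin n × Fin 3) (t : ℝ) :
    (s.area r fun i k => (V + t • Pi.single q 1 : Fin n × Fin 3 → ℝ) (i, k)) =
      (s.area r fun i k => V (i, k)) + t * s.darea r (fun i k => V (i, k)) q := by
  simp only [Step.area, Step.darea, Step.x, Step.z, Node.coord_add_smul_single, Finset.mul_sum,
    ← Finset.sum_add_distrib]
  refine Finset.sum_congr rfl fun m _ => ?_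
  by_cases hq : q.2 = s.l
  · have hw : q.2 ≠ s.w := hq ▸ hlw
    simp only [Node.delta_eq_zero _ hw]
    ring
  · simp only [Node.delta_eq_zero _ hq]
    ring

theorem fderiv_apply_of_affine {E : Type*} [NormedAddCommGroup E] [NormedSpace ℝ E] {f : E → ℝ}
    {x e : E} {D : ℝ} (hf : DifferentiableAt ℝ f x) (hD : ∀ t : ℝ, f (x + t • e) = f x + t * D) :
    fderiv ℝ f x e = D := by
  have h1 : HasDerivAt (fun t : ℝ => f (x + t • e)) (fderiv ℝ f x e) 0 :=
    hf.hasFDerivAt.hasLineDerivAt e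
  have h2 : HasDerivAt (fun t : ℝ => f x + t * D) D 0 := by
    simpa using ((hasDerivAt_id (0 : ℝ)).mul_const D).const_add (f x)
  rw [funext hD] at h1
  exact h1.unique h2

theorem contDiff_sum_prism (S : Fin n → Step n) :
    ContDiff ℝ 2 fun V : Fin n × Fin 3 → ℝ =>
      ∑ a, (r h - V (a, h)) * (S a).area r fun i k => V (i, k) :=
  ContDiff.sum fun a _ => (contDiff_const.sub (contDiff_apply ℝ ℝ (a, h))).mul
    (S a).contDiff_area

theorem contDiffAt_hypervolume (hY : Generic r Y) :
    ContDiffAt ℝ 2 (hypervolume r) (concat Y) := by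
  choose S hS hSa using exists_mem_sweep r Y 0 1 2
  exact (contDiff_sum_prism S).contDiffAt.congr_of_eventuallyEq
    (eventuallyEq_sum_prism hY ⟨by decide, by decide, by decide⟩ hS hSa)

theorem Step.darea_eq_zero {s : Step n} {q : Fin n × Fin 3} (hl : q.2 ≠ s.l) (hw : q.2 ≠ s.w) :
    s.darea r Y q = 0 := by
  simp [Step.darea, Node.delta_eq_zero _ hl, Node.delta_eq_zero _ hw]

theorem fderiv_sum_prism (hx : Axes l w h) {S : Fin n → Step n}
    (hl : ∀ a, (S a).l = l) (hw : ∀ a, (S a).w = w) (V : Fin n × Fin 3 → ℝ) (a : Fin n) :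
    fderiv ℝ (fun V : Fin n × Fin 3 → ℝ =>
      ∑ b, (r h - V (b, h)) * (S b).area r fun i k => V (i, k)) V (Pi.single (a, h) 1) =
      -(S a).area r fun i k => V (i, k) := by
  refine fderiv_apply_of_affine
    ((contDiff_sum_prism S).differentiable (by norm_num)).differentiableAt fun t => ?_
  have h1 : ∀ b, ((S b).area r fun i k => (V + t • Pi.single (a, h) 1 : Fin n × Fin 3 → ℝ) (i, k)) =
      (S b).area r fun i k => V (i, k) := fun b => by
    rw [Step.area_add_smul_single _ (by rw [hl, hw]; exact hx.lw), Step.darea_eq_zero]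
    · simp
    · rw [hl]; exact hx.lh.symm
    · rw [hw]; exact hx.wh.symm
  simp only [h1]
  have h2 : ∀ b, (r h - (V + t • Pi.single (a, h) 1 : Fin n × Fin 3 → ℝ) (b, h)) *
      ((S b).area r fun i k => V (i, k)) = (r h - V (b, h)) * ((S b).area r fun i k => V (i, k)) -
      if b = a then t * (S b).area r fun i k => V (i, k) else 0 := fun b => by
    by_cases hb : b = a
    · subst hb; simp; ring
    · simp [hb]
  simp only [h2, Finset.sum_sub_distrib, Finset.sum_ite_eq', Finset.mem_univ, if_true]
  ring

theorem hessian_eq_neg_darea (hY : Generic r Y) (hx : Axes l w h) {s : Step n}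
    (hs : s ∈ sweep r Y l w h) (q : Fin n × Fin 3) :
    hessian (hypervolume r) (concat Y) (s.a, h) q = -s.darea r Y q := by
  choose S hS hSa using exists_mem_sweep r Y l w h
  have hst := fun a => staircase_of_mem_sweep hY hx (hS a)
  have hsS : S s.a = s := sweep_eq_of_a_eq (hS _) hs (hSa _)
  have h1 : (fun V => fderiv ℝ (hypervolume r) V (Pi.single (s.a, h) 1)) =ᶠ[nhds (concat Y)]
      fun V => -s.area r fun i k => V (i, k) := by
    filter_upwards [(eventuallyEq_sum_prism hY hx hS hSa).fderiv (𝕜 := ℝ)] with V hV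
    rw [hV, fderiv_sum_prism hx (fun a => (hst a).l_eq) (fun a => (hst a).w_eq), hsS]
  rw [hessian, h1.fderiv_eq]
  refine fderiv_apply_of_affine
    ((s.contDiff_area.differentiable (by norm_num)).differentiableAt.neg) fun t => ?_
  have hlw : s.l ≠ s.w := by
    rw [← hsS, (hst _).l_eq, (hst _).w_eq]; exact hx.lw
  rw [s.area_add_smul_single hlw]
  simp only [concat]
  ring

theorem sum_sub_mul_sub (u z : ℕ → ℝ) (A : ℝ) (N : ℕ) :
    ∑ m ∈ Finset.range N, (u (m + 1) - u m) * (z m - A) =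
      -(u 0 * (z 0 - A)) + ∑ m ∈ Finset.range N, u (m + 1) * (z m - z (m + 1)) +
        u N * (z N - A) := by
  induction N with
  | zero => simp
  | succ N ih => rw [Finset.sum_range_succ, ih, Finset.sum_range_succ]; ring

theorem Step.neg_darea (s : Step n) (q : Fin n × Fin 3) :
    -s.darea r Y q =
      (s.xNode 0).delta s.l q * (s.z r Y 0 - s.z r Y (s.N + 1)) +
      (s.zNode (s.N + 1)).delta s.w q * (s.x r Y (s.N + 1) - s.x r Y 0) -
      ∑ m ∈ Finset.range (s.N + 1),
        (s.xNode (m + 1)).delta s.l q * (s.z r Y m - s.z r Y (m + 1)) -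
      ∑ m ∈ Finset.range (s.N + 1),
        (s.zNode m).delta s.w q * (s.x r Y (m + 1) - s.x r Y m) := by
  have h1 := sum_sub_mul_sub (fun m => (s.xNode m).delta s.l q) (s.z r Y) (s.z r Y (s.N + 1))
    (s.N + 1)
  have h2 : ∑ m ∈ Finset.range (s.N + 1), (s.x r Y (m + 1) - s.x r Y m) *
        ((s.zNode m).delta s.w q - (s.zNode (s.N + 1)).delta s.w q) =
      ∑ m ∈ Finset.range (s.N + 1), (s.zNode m).delta s.w q * (s.x r Y (m + 1) - s.x r Y m) -
      (s.zNode (s.N + 1)).delta s.w q * (s.x r Y (s.N + 1) - s.x r Y 0) := by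
    rw [← Finset.sum_range_sub, Finset.mul_sum, ← Finset.sum_sub_distrib]
    exact Finset.sum_congr rfl fun m _ => by ring
  rw [Step.darea, Finset.sum_add_distrib, h2]
  rw [h1]
  ring

/-! ### The recorded entries -/

theorem mem_record {a : Fin n} {k : Fin 3} {v : Node n} {c : Fin 3} {x y : ℝ}
    {p q : Fin n × Fin 3} :
    (⟨p, q, y⟩ : Entry n) ∈ record a k v c x ↔
      p = (a, k) ∧ v = .point q.1 ∧ q.2 = c ∧ y = x := by
  obtain ⟨j, b⟩ := q
  cases v with
  | point i =>
    simp only [record, List.mem_singleton, Entry.mk.injEq, Prod.mk.injEq, Node.point.injEq]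
    tauto
  | first => simp [record]
  | last => simp [record]

/-- The entries of an iteration for the columns of the variables `q`, with their values. -/
inductive Step.Records (r : Fin 3 → ℝ) (Y : Fin n → Fin 3 → ℝ) (s : Step n) :
    Fin n × Fin 3 → ℝ → Prop
  | self_l : s.Records r Y (s.a, s.l) (s.z r Y 0 - s.z r Y (s.N + 1))
  | self_w : s.Records r Y (s.a, s.w) (s.x r Y (s.N + 1) - s.x r Y 0)
  | node_l (m : ℕ) (j : Fin n) (hm : m ≤ s.N) (hj : s.d (m + 1) = .point j) :
      s.Records r Y (j, s.l) (-(s.z r Y m - s.z r Y (m + 1)))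
  | node_w (m : ℕ) (j : Fin n) (hm : m ≤ s.N) (hj : s.d m = .point j) :
      s.Records r Y (j, s.w) (-(s.x r Y (m + 1) - s.x r Y m))

theorem Step.mem_entries {s : Step n} {p q : Fin n × Fin 3} {y : ℝ} :
    (⟨p, q, y⟩ : Entry n) ∈ s.entries r Y ↔ p = (s.a, s.h) ∧ s.Records r Y q y := by
  have hz0 : s.dw r Y 0 = s.z r Y 0 := (s.z_of_le (Nat.zero_le _)).symm
  have hzN : s.dw r Y s.N = s.z r Y s.N := (s.z_of_le le_rfl).symm
  simp only [Step.entries, List.mem_append, mem_record, List.mem_flatMap, List.mem_range]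
  obtain ⟨j, c⟩ := q
  dsimp only
  constructor
  · rintro ((((⟨rfl, h1, rfl, rfl⟩ | ⟨rfl, h1, rfl, rfl⟩) | ⟨rfl, h1, rfl, rfl⟩) |
      ⟨rfl, h1, rfl, rfl⟩) | ⟨m, hm, ⟨rfl, h1, rfl, rfl⟩ | ⟨rfl, h1, rfl, rfl⟩⟩) <;>
      refine ⟨rfl, ?_⟩
    · injection h1 with h1; subst h1
      rw [hz0, ← s.z_last (r := r) (Y := Y)]; exact .self_l
    · injection h1 with h1; subst h1
      rw [← s.x_succ, ← s.x_zero (r := r) (Y := Y)]; exact .self_w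
    · have := Step.Records.node_w (r := r) (Y := Y) 0 j (Nat.zero_le _) h1
      rwa [s.x_succ, s.x_zero] at this
    · have := Step.Records.node_l (r := r) (Y := Y) s.N j le_rfl h1
      rwa [s.z_last, ← hzN] at this
    · have := Step.Records.node_l (r := r) (Y := Y) m j hm.le h1
      rwa [s.z_of_le hm.le, s.z_of_le hm] at this
    · have := Step.Records.node_w (r := r) (Y := Y) (m + 1) j hm h1
      rwa [s.x_succ, s.x_succ] at this
  · rintro ⟨rfl, h1⟩
    cases h1 with
    | self_l => simp [hz0]
    | self_w => simp
    | node_l m j hm hj =>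
      rcases hm.eq_or_lt with rfl | hm
      · exact Or.inl (Or.inr ⟨rfl, hj, rfl, by rw [hzN, s.z_last]⟩)
      · exact Or.inr ⟨m, hm, Or.inl ⟨rfl, hj, rfl, by rw [s.z_of_le hm.le, s.z_of_le hm]⟩⟩
    | node_w m j hm hj =>
      cases m with
      | zero => exact Or.inl (Or.inl (Or.inr ⟨rfl, hj, rfl, by rw [s.x_succ, s.x_zero]⟩))
      | succ m => exact Or.inr ⟨m, hm, Or.inr ⟨rfl, hj, rfl, by rw [s.x_succ, s.x_succ]⟩⟩

theorem Staircase.point_ne {s : Step n} (hs : Staircase r Y l w h s) {m : ℕ} (hm : m ≤ s.N + 1) :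
    s.d m ≠ .point s.a := fun e => (hs.mem _ m hm e).false

theorem Staircase.xNode_inj {s : Step n} (hs : Staircase r Y l w h s) {m k : ℕ}
    (hm : m ≤ s.N + 1) (hk : k ≤ s.N + 1) (hmk : s.xNode m = s.xNode k) : m = k := by
  have hx : s.x r Y m = s.x r Y k := by rw [Step.x, Step.x, hmk]
  by_contra hne
  rcases lt_or_gt_of_ne hne with h1 | h1
  · exact (hs.x_lt _ _ h1 hk).ne hx
  · exact (hs.x_lt _ _ h1 hm).ne' hx

theorem Staircase.zNode_inj {s : Step n} (hs : Staircase r Y l w h s) {m k : ℕ}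
    (hm : m ≤ s.N + 1) (hk : k ≤ s.N + 1) (hmk : s.zNode m = s.zNode k) : m = k := by
  have hx : s.z r Y m = s.z r Y k := by rw [Step.z, Step.z, hmk]
  by_contra hne
  rcases lt_or_gt_of_ne hne with h1 | h1
  · exact (hs.z_lt _ _ h1 hk).ne' hx
  · exact (hs.z_lt _ _ h1 hm).ne hx

theorem Step.xNode_succ (s : Step n) (m : ℕ) : s.xNode (m + 1) = s.d (m + 1) := by
  simp [Step.xNode]

theorem Step.zNode_of_le (s : Step n) {m : ℕ} (hm : m ≤ s.N) : s.zNode m = s.d m := by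
  simp [Step.zNode, show m ≠ s.N + 1 by omega]

theorem Step.xNode_zero (s : Step n) : s.xNode 0 = .point s.a := rfl

theorem Step.zNode_last (s : Step n) : s.zNode (s.N + 1) = .point s.a := by
  simp [Step.zNode]

theorem Staircase.delta_xNode {s : Step n} (hs : Staircase r Y l w h s) {m k : ℕ}
    (hm : m ≤ s.N + 1) (hk : k ≤ s.N + 1) {j : Fin n} (hj : s.xNode k = .point j) :
    (s.xNode m).delta s.l (j, s.l) = if m = k then 1 else 0 := by
  split_ifs with hmk
  · exact Node.delta_of_eq (hmk ▸ hj) rfl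
  · exact Node.delta_of_ne fun e => hmk (hs.xNode_inj hm hk (e.trans hj.symm))

theorem Staircase.delta_zNode {s : Step n} (hs : Staircase r Y l w h s) {m k : ℕ}
    (hm : m ≤ s.N + 1) (hk : k ≤ s.N + 1) {j : Fin n} (hj : s.zNode k = .point j) :
    (s.zNode m).delta s.w (j, s.w) = if m = k then 1 else 0 := by
  split_ifs with hmk
  · exact Node.delta_of_eq (hmk ▸ hj) rfl
  · exact Node.delta_of_ne fun e => hmk (hs.zNode_inj hm hk (e.trans hj.symm))

theorem Staircase.neg_darea_l {s : Step n} (hs : Staircase r Y l w h s) (hlw : s.l ≠ s.w)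
    {k : ℕ} (hk : k ≤ s.N + 1) {j : Fin n} (hj : s.xNode k = .point j) :
    -s.darea r Y (j, s.l) = if k = 0 then s.z r Y 0 - s.z r Y (s.N + 1)
      else -(s.z r Y (k - 1) - s.z r Y k) := by
  have hw : ∀ v : Node n, v.delta s.w (j, s.l) = 0 := fun v => v.delta_eq_zero hlw
  have h1 : ∑ m ∈ Finset.range (s.N + 1),
      (s.xNode (m + 1)).delta s.l (j, s.l) * (s.z r Y m - s.z r Y (m + 1)) =
      ∑ m ∈ Finset.range (s.N + 1), if m + 1 = k then s.z r Y m - s.z r Y (m + 1) else 0 :=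
    Finset.sum_congr rfl fun m hm => by
      rw [hs.delta_xNode (by simpa using hm) hk hj, ite_mul, one_mul, zero_mul]
  rw [s.neg_darea, h1, hs.delta_xNode (Nat.zero_le _) hk hj]
  cases k with
  | zero => simp [hw]
  | succ k => simp [hw, Nat.lt_of_succ_le hk]

theorem Staircase.neg_darea_w {s : Step n} (hs : Staircase r Y l w h s) (hlw : s.l ≠ s.w)
    {k : ℕ} (hk : k ≤ s.N + 1) {j : Fin n} (hj : s.zNode k = .point j) :
    -s.darea r Y (j, s.w) = if k = s.N + 1 then s.x r Y (s.N + 1) - s.x r Y 0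
      else -(s.x r Y (k + 1) - s.x r Y k) := by
  have hl : ∀ v : Node n, v.delta s.l (j, s.w) = 0 := fun v => v.delta_eq_zero hlw.symm
  have h1 : ∑ m ∈ Finset.range (s.N + 1),
      (s.zNode m).delta s.w (j, s.w) * (s.x r Y (m + 1) - s.x r Y m) =
      ∑ m ∈ Finset.range (s.N + 1), if m = k then s.x r Y (m + 1) - s.x r Y m else 0 :=
    Finset.sum_congr rfl fun m hm => by
      rw [hs.delta_zNode (by rw [Finset.mem_range] at hm; omega) hk hj, ite_mul, one_mul, zero_mul]
  rw [s.neg_darea, h1, hs.delta_zNode le_rfl hk hj]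
  rcases hk.eq_or_lt with rfl | hk
  · simp [hl]
  · simp [hl, hk, hk.ne, hk.ne']

theorem Staircase.records_iff {s : Step n} (hs : Staircase r Y l w h s) (hlw : s.l ≠ s.w)
    {q : Fin n × Fin 3} {y : ℝ} :
    s.Records r Y q y ↔ -s.darea r Y q = y ∧ y ≠ 0 := by
  have key : ∀ y, s.Records r Y q y → -s.darea r Y q = y ∧ y ≠ 0 := by
    intro y hy
    cases hy with
    | self_l =>
      refine ⟨?_, (sub_pos.2 (hs.z_lt _ _ (Nat.succ_pos _) le_rfl)).ne'⟩
      rw [hs.neg_darea_l hlw (Nat.zero_le _) s.xNode_zero, if_pos rfl]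
    | self_w =>
      refine ⟨?_, (sub_pos.2 (hs.x_lt _ _ (Nat.succ_pos _) le_rfl)).ne'⟩
      rw [hs.neg_darea_w hlw le_rfl s.zNode_last, if_pos rfl]
    | node_l m j hm hj =>
      refine ⟨?_, (neg_neg_of_pos (sub_pos.2 (hs.z_lt _ _ (Nat.lt_succ_self _) (by omega)))).ne⟩
      rw [hs.neg_darea_l hlw (k := m + 1) (by omega) (by rw [s.xNode_succ, hj]),
        if_neg (by omega), Nat.add_sub_cancel]
    | node_w m j hm hj =>
      refine ⟨?_, (neg_neg_of_pos (sub_pos.2 (hs.x_lt _ _ (Nat.lt_succ_self _) (by omega)))).ne⟩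
      rw [hs.neg_darea_w hlw (k := m) (by omega) (by rw [s.zNode_of_le hm, hj]),
        if_neg (by omega)]
  refine ⟨key y, fun ⟨h1, h2⟩ => ?_⟩
  suffices hex : ∃ y', s.Records r Y q y' by
    obtain ⟨y', hy'⟩ := hex
    rwa [← h1, (key y' hy').1]
  by_contra hex
  refine h2 (h1 ▸ ?_)
  obtain ⟨j, c⟩ := q
  have hl : ∀ m, m ≤ s.N + 1 → (s.xNode m).delta s.l (j, c) = 0 := fun m hm => by
    by_contra hne
    obtain ⟨h3, h4⟩ := Node.eq_of_delta_ne_zero hne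
    dsimp only at h3 h4
    subst h4
    cases m with
    | zero =>
      rw [s.xNode_zero] at h3
      injection h3 with h3; subst h3
      exact hex ⟨_, .self_l⟩
    | succ m => exact hex ⟨_, .node_l m j (by omega) (by rw [← s.xNode_succ, h3])⟩
  have hw : ∀ m, m ≤ s.N + 1 → (s.zNode m).delta s.w (j, c) = 0 := fun m hm => by
    by_contra hne
    obtain ⟨h3, h4⟩ := Node.eq_of_delta_ne_zero hne
    dsimp only at h3 h4
    subst h4
    rcases hm.eq_or_lt with rfl | hm
    · rw [s.zNode_last] at h3
      injection h3 with h3; subst h3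
      exact hex ⟨_, .self_w⟩
    · exact hex ⟨_, .node_w m j (by omega) (by rw [← s.zNode_of_le (by omega), h3])⟩
  rw [s.neg_darea, hl 0 (by omega), hw _ le_rfl, Finset.sum_eq_zero, Finset.sum_eq_zero]
  · ring
  · intro m hm
    rw [Finset.mem_range] at hm
    rw [hw m (by omega), zero_mul]
  · intro m hm
    rw [Finset.mem_range] at hm
    rw [hl (m + 1) (by omega), zero_mul]

/-! ### Edges of the swept polygons -/

theorem mem_staircasePolygon {a b : ℝ} {X Z : ℕ → ℝ} {N : ℕ} {p : ℝ × ℝ} :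
    p ∈ (⋃ j ∈ Finset.range (N + 1), Set.Icc a (X (j + 1)) ×ˢ Set.Icc b (Z j)) ↔
      a ≤ p.1 ∧ b ≤ p.2 ∧ ∃ j ≤ N, p.1 ≤ X (j + 1) ∧ p.2 ≤ Z j := by
  simp only [Set.mem_iUnion, Finset.mem_range, Set.mem_prod, Set.mem_Icc, exists_prop,
    Nat.lt_succ_iff]
  constructor
  · rintro ⟨j, hj, ⟨h1, h2⟩, h3, h4⟩
    exact ⟨h1, h3, j, hj, h2, h4⟩
  · rintro ⟨h1, h3, j, hj, h2, h4⟩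
    exact ⟨j, hj, ⟨h1, h2⟩, h3, h4⟩

theorem mem_interior_staircasePolygon {a b : ℝ} {X Z : ℕ → ℝ} {N : ℕ} {p : ℝ × ℝ} :
    p ∈ interior (⋃ j ∈ Finset.range (N + 1), Set.Icc a (X (j + 1)) ×ˢ Set.Icc b (Z j)) ↔
      a < p.1 ∧ b < p.2 ∧ ∃ j ≤ N, p.1 < X (j + 1) ∧ p.2 < Z j := by
  constructor
  · intro hp
    rw [mem_interior_iff_mem_nhds, Metric.mem_nhds_iff] at hp
    obtain ⟨ε, hε, hsub⟩ := hp
    have hball : ∀ t : ℝ, |t| < ε → (p.1 + t, p.2 + t) ∈ Metric.ball p ε := fun t ht => by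
      rw [Metric.mem_ball, Prod.dist_eq]
      simpa [Real.dist_eq] using ht
    have h1 := mem_staircasePolygon.1 (hsub (hball (ε / 2) (by
      rw [abs_of_pos (by positivity)]; linarith)))
    have h2 := mem_staircasePolygon.1 (hsub (hball (-(ε / 2)) (by
      rw [abs_neg, abs_of_pos (by positivity)]; linarith)))
    obtain ⟨-, -, j, hj, h3, h4⟩ := h1
    dsimp only at h2 h3 h4
    exact ⟨by linarith [h2.1], by linarith [h2.2.1], j, hj, by linarith, by linarith⟩
  · rintro ⟨h1, h2, j, hj, h3, h4⟩
    refine mem_interior.2 ⟨Set.Ioo a (X (j + 1)) ×ˢ Set.Ioo b (Z j), ?_,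
      isOpen_Ioo.prod isOpen_Ioo, ⟨h1, h3⟩, h2, h4⟩
    rintro q ⟨h5, h6⟩
    exact mem_staircasePolygon.2 ⟨h5.1.le, h6.1.le, j, hj, h5.2.le, h6.2.le⟩

theorem mem_frontier_staircasePolygon {a b : ℝ} {X Z : ℕ → ℝ} {N : ℕ} {p : ℝ × ℝ} :
    p ∈ frontier (⋃ j ∈ Finset.range (N + 1), Set.Icc a (X (j + 1)) ×ˢ Set.Icc b (Z j)) ↔
      (a ≤ p.1 ∧ b ≤ p.2 ∧ ∃ j ≤ N, p.1 ≤ X (j + 1) ∧ p.2 ≤ Z j) ∧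
        ¬ (a < p.1 ∧ b < p.2 ∧ ∃ j ≤ N, p.1 < X (j + 1) ∧ p.2 < Z j) := by
  have hc : IsClosed (⋃ j ∈ Finset.range (N + 1), Set.Icc a (X (j + 1)) ×ˢ Set.Icc b (Z j)) :=
    isClosed_biUnion_finset fun j _ => isClosed_Icc.prod isClosed_Icc
  rw [hc.frontier_eq, Set.mem_sdiff, mem_staircasePolygon, mem_interior_staircasePolygon]

/-- A slice of a staircase polygon by an edge line has the length of the edge. -/
theorem volume_slice {S : Set ℝ} {b β γ : ℝ} (hγβ : γ ≤ β) (hbγ : b ≤ γ)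
    (hS : ∀ t, t ∈ S ↔ (b ≤ t ∧ t ≤ β) ∧ ¬ (b < t ∧ t < γ)) :
    (volume S).toReal = β - γ := by
  have : S =ᵐ[volume] Set.Icc γ β := by
    filter_upwards [Measure.ae_ne volume b] with t ht
    refine propext ((hS t).trans (Iff.trans ?_ Set.mem_Icc.symm))
    constructor
    · rintro ⟨⟨h1, h2⟩, h3⟩
      exact ⟨not_lt.1 fun h4 => h3 ⟨lt_of_le_of_ne h1 (Ne.symm ht), h4⟩, h2⟩
    · rintro ⟨h1, h2⟩
      exact ⟨⟨hbγ.trans h1, h2⟩, fun h3 => h3.2.not_ge h1⟩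
  rw [measure_congr this, Real.volume_Icc, ENNReal.toReal_ofReal (sub_nonneg.2 hγβ)]

section Slices

variable {X Z : ℕ → ℝ} {N : ℕ}

theorem edgeLengthFst_zero (hX : ∀ i j, i < j → j ≤ N + 1 → X i < X j)
    (hZ : ∀ i j, i < j → j ≤ N + 1 → Z j < Z i) :
    edgeLengthFst (⋃ j ∈ Finset.range (N + 1),
      Set.Icc (X 0) (X (j + 1)) ×ˢ Set.Icc (Z (N + 1)) (Z j)) (X 0) = Z 0 - Z (N + 1) := by
  refine volume_slice (b := Z (N + 1)) (hZ 0 (N + 1) (by omega) le_rfl).le le_rfl fun t => ?_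
  rw [Set.mem_ofPred_eq, mem_frontier_staircasePolygon]
  constructor
  · rintro ⟨⟨-, h2, j, hj, h3, h4⟩, -⟩
    refine ⟨⟨h2, ?_⟩, fun h5 => lt_asymm h5.1 h5.2⟩
    rcases Nat.eq_zero_or_pos j with rfl | hj0
    · exact h4
    · exact h4.trans (hZ 0 j hj0 (by omega)).le
  · rintro ⟨⟨h1, h2⟩, -⟩
    exact ⟨⟨le_rfl, h1, 0, by omega, (hX 0 1 (by omega) (by omega)).le, h2⟩,
      fun h3 => lt_irrefl _ h3.1⟩

theorem edgeLengthFst_succ (hX : ∀ i j, i < j → j ≤ N + 1 → X i < X j)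
    (hZ : ∀ i j, i < j → j ≤ N + 1 → Z j < Z i) {k : ℕ} (hk : k ≤ N) :
    edgeLengthFst (⋃ j ∈ Finset.range (N + 1),
      Set.Icc (X 0) (X (j + 1)) ×ˢ Set.Icc (Z (N + 1)) (Z j)) (X (k + 1)) = Z k - Z (k + 1) := by
  have hX' : ∀ i j, i ≤ j → j ≤ N + 1 → X i ≤ X j := fun i j hij hj =>
    hij.eq_or_lt.elim (fun e => e ▸ le_rfl) fun e => (hX i j e hj).le
  have hZ' : ∀ i j, i ≤ j → j ≤ N + 1 → Z j ≤ Z i := fun i j hij hj =>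
    hij.eq_or_lt.elim (fun e => e ▸ le_rfl) fun e => (hZ i j e hj).le
  refine volume_slice (b := Z (N + 1)) (hZ' k (k + 1) (by omega) (by omega))
    (hZ' (k + 1) (N + 1) (by omega) le_rfl) fun t => ?_
  rw [Set.mem_ofPred_eq, mem_frontier_staircasePolygon]
  dsimp only
  refine and_congr ⟨?_, ?_⟩ (not_congr ⟨?_, ?_⟩)
  · rintro ⟨-, h2, j, hj, h3, h4⟩
    refine ⟨h2, h4.trans (hZ' k j ?_ (by omega))⟩
    by_contra! hjk
    exact h3.not_gt (hX (j + 1) (k + 1) (by omega) (by omega))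
  · rintro ⟨h1, h2⟩
    exact ⟨hX' 0 (k + 1) (by omega) (by omega), h1, k, hk, le_rfl, h2⟩
  · rintro ⟨-, h2, j, hj, h3, h4⟩
    refine ⟨h2, h4.trans_le (hZ' (k + 1) j ?_ (by omega))⟩
    by_contra! hjk
    exact h3.not_ge (hX' (j + 1) (k + 1) (by omega) (by omega))
  · rintro ⟨h1, h2⟩
    have hkN : k + 1 ≤ N := by
      by_contra! hkN
      obtain rfl : k = N := by omega
      exact lt_asymm h1 h2
    exact ⟨hX 0 (k + 1) (by omega) (by omega), h1, k + 1, hkN,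
      hX (k + 1) (k + 2) (by omega) (by omega), h2⟩

theorem edgeLengthSnd_last (hX : ∀ i j, i < j → j ≤ N + 1 → X i < X j)
    (hZ : ∀ i j, i < j → j ≤ N + 1 → Z j < Z i) :
    edgeLengthSnd (⋃ j ∈ Finset.range (N + 1),
      Set.Icc (X 0) (X (j + 1)) ×ˢ Set.Icc (Z (N + 1)) (Z j)) (Z (N + 1)) = X (N + 1) - X 0 := by
  refine volume_slice (b := X 0) (hX 0 (N + 1) (by omega) le_rfl).le le_rfl fun t => ?_
  rw [Set.mem_ofPred_eq, mem_frontier_staircasePolygon]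
  constructor
  · rintro ⟨⟨h2, -, j, hj, h3, h4⟩, -⟩
    refine ⟨⟨h2, ?_⟩, fun h5 => lt_asymm h5.1 h5.2⟩
    rcases hj.eq_or_lt with rfl | hj0
    · exact h3
    · exact h3.trans (hX (j + 1) (N + 1) (by omega) le_rfl).le
  · rintro ⟨⟨h1, h2⟩, -⟩
    exact ⟨⟨h1, le_rfl, N, le_rfl, h2, (hZ N (N + 1) (by omega) le_rfl).le⟩,
      fun h3 => lt_irrefl _ h3.2.1⟩

theorem edgeLengthSnd_of_le (hX : ∀ i j, i < j → j ≤ N + 1 → X i < X j)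
    (hZ : ∀ i j, i < j → j ≤ N + 1 → Z j < Z i) {k : ℕ} (hk : k ≤ N) :
    edgeLengthSnd (⋃ j ∈ Finset.range (N + 1),
      Set.Icc (X 0) (X (j + 1)) ×ˢ Set.Icc (Z (N + 1)) (Z j)) (Z k) = X (k + 1) - X k := by
  have hX' : ∀ i j, i ≤ j → j ≤ N + 1 → X i ≤ X j := fun i j hij hj =>
    hij.eq_or_lt.elim (fun e => e ▸ le_rfl) fun e => (hX i j e hj).le
  have hZ' : ∀ i j, i ≤ j → j ≤ N + 1 → Z j ≤ Z i := fun i j hij hj =>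
    hij.eq_or_lt.elim (fun e => e ▸ le_rfl) fun e => (hZ i j e hj).le
  refine volume_slice (b := X 0) (hX' k (k + 1) (by omega) (by omega))
    (hX' 0 k (by omega) (by omega)) fun t => ?_
  rw [Set.mem_ofPred_eq, mem_frontier_staircasePolygon]
  dsimp only
  refine and_congr ⟨?_, ?_⟩ (not_congr ⟨?_, ?_⟩)
  · rintro ⟨h2, -, j, hj, h3, h4⟩
    refine ⟨h2, h3.trans (hX' (j + 1) (k + 1) ?_ (by omega))⟩
    by_contra! hjk
    exact h4.not_gt (hZ k j (by omega) (by omega))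
  · rintro ⟨h1, h2⟩
    exact ⟨h1, hZ' k (N + 1) (by omega) le_rfl, k, hk, h2, le_rfl⟩
  · rintro ⟨h2, -, j, hj, h3, h4⟩
    refine ⟨h2, h3.trans_le (hX' (j + 1) k ?_ (by omega))⟩
    by_contra! hjk
    exact h4.not_ge (hZ' k j (by omega) (by omega))
  · rintro ⟨h1, h2⟩
    cases k with
    | zero => exact absurd h2 (lt_asymm h1)
    | succ k =>
      exact ⟨h1, hZ (k + 1) (N + 1) (by omega) le_rfl, k, by omega, h2,
        hZ k (k + 1) (by omega) (by omega)⟩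

end Slices

theorem Step.polygon_eq (s : Step n) : s.polygon r Y =
    ⋃ j ∈ Finset.range (s.N + 1),
      Set.Icc (s.x r Y 0) (s.x r Y (j + 1)) ×ˢ Set.Icc (s.z r Y (s.N + 1)) (s.z r Y j) := by
  refine Set.iUnion₂_congr fun j hj => ?_
  rw [s.x_zero, s.x_succ, s.z_last, s.z_of_le (by rw [Finset.mem_range] at hj; omega)]

theorem Step.x_of_xNode {s : Step n} {m : ℕ} {j : Fin n} (hj : s.xNode m = .point j) :
    Y j s.l = s.x r Y m := by
  simp [Step.x, hj]

theorem Step.z_of_zNode {s : Step n} {m : ℕ} {j : Fin n} (hj : s.zNode m = .point j) :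
    Y j s.w = s.z r Y m := by
  simp [Step.z, hj]

theorem Staircase.edgeLength {s : Step n} (hs : Staircase r Y l w h s) {q : Fin n × Fin 3} {y : ℝ}
    (hq : s.Records r Y q y) :
    (q.2 = s.l ∧ y = (if q.1 = s.a then 1 else -1) *
      edgeLengthFst (s.polygon r Y) (Y q.1 s.l)) ∨
    (q.2 = s.w ∧ y = (if q.1 = s.a then 1 else -1) *
      edgeLengthSnd (s.polygon r Y) (Y q.1 s.w)) := by
  have hne : ∀ {m j}, m ≤ s.N + 1 → s.d m = .point j → j ≠ s.a := fun hm hj e =>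
    hs.point_ne hm (hj.trans (e ▸ rfl))
  rw [s.polygon_eq]
  cases hq with
  | self_l =>
    refine Or.inl ⟨rfl, ?_⟩
    rw [if_pos rfl, one_mul, Step.x_of_xNode (r := r) (Y := Y) s.xNode_zero,
      edgeLengthFst_zero hs.x_lt hs.z_lt]
  | self_w =>
    refine Or.inr ⟨rfl, ?_⟩
    rw [if_pos rfl, one_mul, Step.z_of_zNode (r := r) (Y := Y) s.zNode_last,
      edgeLengthSnd_last hs.x_lt hs.z_lt]
  | node_l m j hm hj =>
    refine Or.inl ⟨rfl, ?_⟩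
    rw [if_neg (hne (by omega) hj), Step.x_of_xNode (r := r) (Y := Y) ((s.xNode_succ m).trans hj),
      edgeLengthFst_succ hs.x_lt hs.z_lt hm, neg_one_mul]
  | node_w m j hm hj =>
    refine Or.inr ⟨rfl, ?_⟩
    rw [if_neg (hne (by omega) hj), Step.z_of_zNode (r := r) (Y := Y) ((s.zNode_of_le hm).trans hj),
      edgeLengthSnd_of_le hs.x_lt hs.z_lt hm, neg_one_mul]

theorem exists_axes_of_mem_steps {s : Step n} (hs : s ∈ steps r Y) :
    ∃ l w h, Axes l w h ∧ s ∈ sweep r Y l w h := by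
  simp only [steps, List.mem_append] at hs
  rcases hs with (hs | hs) | hs
  · exact ⟨0, 1, 2, ⟨by decide, by decide, by decide⟩, hs⟩
  · exact ⟨0, 2, 1, ⟨by decide, by decide, by decide⟩, hs⟩
  · exact ⟨2, 1, 0, ⟨by decide, by decide, by decide⟩, hs⟩

theorem exists_mem_steps (r : Fin 3 → ℝ) (Y : Fin n → Fin 3 → ℝ) (a : Fin n) (k : Fin 3) :
    ∃ l w, Axes l w k ∧ ∃ s ∈ steps r Y, s ∈ sweep r Y l w k ∧ s.a = a := by
  have : ∃ l w, Axes l w k ∧ ∀ s ∈ sweep r Y l w k, s ∈ steps r Y := by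
    have hk : k = 0 ∨ k = 1 ∨ k = 2 := by omega
    rcases hk with rfl | rfl | rfl
    · exact ⟨2, 1, ⟨by decide, by decide, by decide⟩, fun s hs => by simp [steps, hs]⟩
    · exact ⟨0, 2, ⟨by decide, by decide, by decide⟩, fun s hs => by simp [steps, hs]⟩
    · exact ⟨0, 1, ⟨by decide, by decide, by decide⟩, fun s hs => by simp [steps, hs]⟩
  obtain ⟨l, w, hx, hsub⟩ := this
  obtain ⟨s, hs, hsa⟩ := exists_mem_sweep r Y l w k a
  exact ⟨l, w, hx, s, hsub s hs, hs, hsa⟩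

theorem records_iff_hessian (hY : Generic r Y) (hx : Axes l w h) {s : Step n}
    (hs : s ∈ sweep r Y l w h) {q : Fin n × Fin 3} {y : ℝ} :
    s.Records r Y q y ↔
      hessian (hypervolume r) (concat Y) (s.a, s.h) q = y ∧ y ≠ 0 := by
  have hst := staircase_of_mem_sweep hY hx hs
  rw [hst.records_iff (by rw [hst.l_eq, hst.w_eq]; exact hx.lw), hst.h_eq,
    hessian_eq_neg_darea hY hx hs]

theorem mem_triSweep_iff (hY : Generic r Y) (p q : Fin n × Fin 3) (y : ℝ) :
    (⟨p, q, y⟩ : Entry n) ∈ triSweep r Y ↔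
      hessian (hypervolume r) (concat Y) p q = y ∧ y ≠ 0 := by
  simp only [triSweep, List.mem_flatMap, Step.mem_entries]
  constructor
  · rintro ⟨s, hs, rfl, hq⟩
    obtain ⟨l, w, h, hx, hsw⟩ := exists_axes_of_mem_steps hs
    exact (records_iff_hessian hY hx hsw).1 hq
  · intro H
    obtain ⟨a, k⟩ := p
    obtain ⟨l, w, hx, s, hs, hsw, rfl⟩ := exists_mem_steps r Y a k
    obtain rfl := (staircase_of_mem_sweep hY hx hsw).h_eq
    exact ⟨s, hs, rfl, (records_iff_hessian hY hx hsw).2 H⟩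

theorem edgeLength_of_mem_entries (hY : Generic r Y) {s : Step n} (hs : s ∈ steps r Y)
    {e : Entry n} (he : e ∈ s.entries r Y) :
    (e.col.2 = s.l ∧ e.val = (if e.col.1 = s.a then 1 else -1) *
      edgeLengthFst (s.polygon r Y) (Y e.col.1 s.l)) ∨
    (e.col.2 = s.w ∧ e.val = (if e.col.1 = s.a then 1 else -1) *
      edgeLengthSnd (s.polygon r Y) (Y e.col.1 s.w)) := by
  obtain ⟨l, w, h, hx, hsw⟩ := exists_axes_of_mem_steps hs
  exact (staircase_of_mem_sweep hY hx hsw).edgeLength (Step.mem_entries.1 he).2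

end

end TriSweep

theorem mainTheorem2 (n : ℕ) (r : Fin 3 → ℝ) (Y : Fin n → Fin 3 → ℝ)
    (hnd : ∀ i j, ¬ TriSweep.Dominates (Y i) (Y j))
    (hgen : ∀ i j, i ≠ j → ∀ k, Y i k ≠ Y j k)
    (hr : ∀ i k, Y i k < r k) :
    -- the Hessian exists
    ContDiffAt ℝ 2 (TriSweep.hypervolume r) (TriSweep.concat Y) ∧
    -- the output consists of exactly the non-zero entries, with their values
    (∀ (p q : Fin n × Fin 3) (x : ℝ),
      (⟨p, q, x⟩ : TriSweep.Entry n) ∈ TriSweep.triSweep r Y ↔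
        TriSweep.hessian (TriSweep.hypervolume r) (TriSweep.concat Y) p q = x ∧ x ≠ 0) ∧
    -- each entry is, up to its sign, the length of the edge of the polygon of its iteration
    -- on the line fixed by the column coordinate
    (∀ s ∈ TriSweep.steps r Y, ∀ e ∈ s.entries r Y,
      (e.col.2 = s.l ∧
        e.val = (if e.col.1 = s.a then 1 else -1) *
          TriSweep.edgeLengthFst (s.polygon r Y) (Y e.col.1 s.l)) ∨
      (e.col.2 = s.w ∧
        e.val = (if e.col.1 = s.a then 1 else -1) *
          TriSweep.edgeLengthSnd (s.polygon r Y) (Y e.col.1 s.w))) := by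
  have hY : TriSweep.Generic r Y := ⟨hnd, hgen, hr⟩
  exact ⟨TriSweep.contDiffAt_hypervolume hY, TriSweep.mem_triSweep_iff hY,
    fun _ hs _ he => TriSweep.edgeLength_of_mem_entries hY hs he⟩
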